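/- **Setting.** Let $d,n,T\ge 1$ be integers, $B>0$, $\delta\in(0,1)$ and $\Theta=\{\theta\in\mathbb R^d:\|\theta\|_2\le B\}$. A data set $D_n=\{(X_i,Y_i)\}_{i=1}^n$ from the linear model with regression vector $\theta$ consists of $n$ i.i.d. pairs with $X_i\sim\mathcal N(0,I_d)$, $Y_i=\langle X_i,\theta\rangle+\epsilon_i$, $\epsilon_i\sim\mathcal N(0,1)$ independent of $X_i$. The set $\mathcal D$ of deterministic estimators consists of the measurable maps from data sets to $\Theta$, and $\mathcal M_{\mathcal D}$ is the set of probability measures on $\mathcal D$ (randomized estimators). The risk is $R(\hat\theta,\theta)=\mathbb E_{D_n}\|\hat\theta(D_n)-\theta\|_2^2$ (averaged over $\hat\theta$ as well for a randomized estimator), $R(\hat\theta,P)=\mathbb E_{\theta\sim P}R(\hat\theta,\theta)$, and $R^*=\inf_{\hat\theta\in\mathcal M_{\mathcal D}}\sup_{\theta\in\Theta}R(\hat\theta,\theta)$. **Algorithm.** Put $\eta=\frac{1}{B(B\sqrt n+1)\sqrt T}$, $w=\frac{B}{T^{3/2}}$, $K=\lceil B/w\rceil$, $N_1=\lceil \frac{T^3}{(B\sqrt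 n+1)^2}\rceil$, $N_2=\lceil\frac{T^4}{(B\sqrt n+1)^2}\rceil$ and $b_j=jB/K$ for $1\le j\le K$. For $t=1,\dots,T$: * *(maximization, grid search)* Let $P_t$ be the distribution, given $\hat\theta_1,\dots,\hat\theta_{t-1}$, of the following random grid point: draw $\sigma\sim\mathrm{Exp}(\eta)$; for all $i<t$ and $j\le K$ draw $N_1$ independent data sets $D_{n,1},\dots,D_{n,N_1}$ from the model with regression vector $b_j\mathbf e_1$ and put $\hat R_{i,j}=\frac1{N_1}\sum_{k}\|\hat\theta_i(D_{n,k})-b_j\mathbf e_1\|_2^2$; output a $b_j$ that maximizes $\sum_{i<t}\hat R_{i,j}+\sigma b_j$ (ties are broken by any fixed measurable rule). Draw $N_2$ independent samples $b_{t,1},\dots,b_{t,N_2}$ from $P_t$ and let $\hat P_t$ be their empirical distribution. * *(minimization, Fisher–Bingham Bayes oracle)* With $C(A,\gamma)=\int_{\mathbb S^{d-1}}\exp(-Z^TAZ+\langle\gamma,Z\rangle)\,dZ$, $\mathbf X=[X_1,\dots,X_n]^T$ and $\mathbf Y=[Y_1,\dots,Y_n]^T$, put $$\hat\theta_t(D_n)=\frac{\sum_{k=1}^{N_2}b_{t,k}\,\frac{\partial}{\partial\gamma}C\big(2^{-1}b_{t,k}^2\mathbf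 X^T\mathbf X,\gamma\big)\Big|_{\gamma=b_{t,k}\mathbf X^T\mathbf Y}}{\sum_{k=1}^{N_2}C\big(2^{-1}b_{t,k}^2\mathbf X^T\mathbf X,\,b_{t,k}\mathbf X^T\mathbf Y\big)} .$$ Let $\hat\theta_{\rm avg}=\frac1T\sum_{t=1}^T\hat\theta_t$ and $\hat P_{\rm avg}=\frac1T\sum_{t=1}^T\hat P_t$, and let $\hat P_{\rm LFP}$ be the law of $bU$ with $b\sim\hat P_{\rm avg}$ and $U$ uniform on the unit sphere, independent of $b$ (the radial extension of $\hat P_{\rm avg}$, with density proportional to $\|\theta\|_2^{1-d}\hat P_{\rm avg}(\|\theta\|_2)$). **Theorem.** There are universal constants $C>0$ and $p\in\mathbb N$ such that, for all such $d,n,T,B,\delta$, with $$\varepsilon=C\,B^2(B+1)\sqrt{\frac nT}\,\Big(1+\log\frac T\delta\Big)^{p}=\tilde O\Big(B^2(B+1)\sqrt{\tfrac nT}\Big),$$ $\hat\theta_{\rm avg}$ always belongs to $\mathcal D$ and 1. with probability at least $1-\delta$, $\ \sup_{\|\theta\|_2\le B}R(\hat\theta_{\rm avg},\theta)\le R^*+\varepsilon$;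 2. with probability at least $1-\delta$, $\ \inf_{\hat\theta\in\mathcal D}R(\hat\theta,\hat P_{\rm LFP})\ge R^*-\varepsilon$. -/

import Mathlib

open MeasureTheory ProbabilityTheory Matrix Metric
open scoped BigOperators Gradient

noncomputable section

namespace RegressionGame

/-! ### The statistical game -/

/-- The space `ℝ^d` of regression vectors, with the Euclidean norm. -/
abbrev Vec (d : ℕ) : Type := EuclideanSpace ℝ (Fin d)

/-- A data set of `n` covariate / response pairs `(X_i, Y_i)`. -/
abbrev Data (d n : ℕ) : Type := Fin n → Vec d × ℝ

/-- The law of one pair `(X, ⟨X, θ⟩ + ε)` with independent `X ∼ N(0, I)` and `ε ∼ N(0, 1)`. -/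
def sampleLaw {d : ℕ} (θ : Vec d) : Measure (Vec d × ℝ) :=
  ((stdGaussian (Vec d)).prod (gaussianReal 0 1)).map
    (fun p => (p.1, inner ℝ p.1 θ + p.2))

/-- The law of `n` independent samples from the linear model with regression vector `θ`. -/
def dataLaw {d : ℕ} (n : ℕ) (θ : Vec d) : Measure (Data d n) :=
  Measure.pi (fun _ : Fin n => sampleLaw θ)

/-- The risk of the map `f` from data to `ℝ^d` at `θ`, for the squared Euclidean loss. -/
def risk {d n : ℕ} (f : Data d n → Vec d) (θ : Vec d) : ℝ :=
  ∫ D, ‖f D - θ‖ ^ 2 ∂(dataLaw n θ)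

/-- A map from data to `ℝ^d` is an estimator if it is measurable and takes its values in the
parameter space, the closed ball of radius `B`. -/
def IsEstimator {d n : ℕ} (B : ℝ) (f : Data d n → Vec d) : Prop :=
  Measurable f ∧ ∀ D, f D ∈ closedBall (0 : Vec d) B

/-- The set of deterministic estimators. -/
structure Estimator (d n : ℕ) (B : ℝ) where
  toFun : Data d n → Vec d
  isEstimator : IsEstimator B toFun

/-- The coarsest `σ`-algebra on deterministic estimators for which all the risks
`θ̂ ↦ R(θ̂, θ)` are measurable, so that the risk of a random estimator makes sense. -/
instance (d n : ℕ) (B : ℝ) : MeasurableSpace (Estimator d n B) :=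
  ⨆ θ : closedBall (0 : Vec d) B,
    MeasurableSpace.comap (fun f : Estimator d n B => risk f.toFun (θ : Vec d)) inferInstance

/-- The worst-case risk over the ball of radius `B`. -/
def worstRisk {d n : ℕ} (B : ℝ) (f : Data d n → Vec d) : ℝ :=
  ⨆ θ : closedBall (0 : Vec d) B, risk f (θ : Vec d)

/-- The minimax risk `R*`: the infimum, over all randomized estimators (probability measures on
the set of deterministic estimators), of the worst-case risk. -/
def minimaxRisk (d n : ℕ) (B : ℝ) : ℝ :=
  ⨅ ν : ProbabilityMeasure (Estimator d n B),
    ⨆ θ : closedBall (0 : Vec d) B,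
      ∫ f : Estimator d n B, risk f.toFun (θ : Vec d) ∂(ν : Measure (Estimator d n B))

/-- The Bayes risk of the prior `P`: the infimum of the integrated risk over all deterministic
estimators. -/
def bayesRisk {d : ℕ} (n : ℕ) (B : ℝ) (P : Measure (Vec d)) : ℝ :=
  ⨅ f : Estimator d n B, ∫ θ, risk f.toFun θ ∂P

/-! ### The minimization oracle -/

/-- The surface measure of the unit sphere of `ℝ^d`. -/
def surface (d : ℕ) : Measure (sphere (0 : Vec d) 1) := (volume : Measure (Vec d)).toSphere

/-- The normalization constant `C(A, γ) = ∫ exp(-Zᵀ A Z + ⟨γ, Z⟩) dZ` of the Fisher–Bingham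
distribution on the unit sphere. -/
def fbConst {d : ℕ} (A : Matrix (Fin d) (Fin d) ℝ) (γ : Vec d) : ℝ :=
  ∫ Z : sphere (0 : Vec d) 1,
    Real.exp (-((Z : Vec d).ofLp ⬝ᵥ (A *ᵥ (Z : Vec d).ofLp)) + inner ℝ γ (Z : Vec d)) ∂(surface d)

/-- The design matrix, whose rows are the covariates. -/
def design {d n : ℕ} (D : Data d n) : Matrix (Fin n) (Fin d) ℝ :=
  Matrix.of (fun i j => (D i).1 j)

/-- The vector of the responses. -/
def response {d n : ℕ} (D : Data d n) : Fin n → ℝ := fun i => (D i).2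

/-- The parameter `2⁻¹ b² Xᵀ X`. -/
def fbMatrix {d n : ℕ} (D : Data d n) (b : ℝ) : Matrix (Fin d) (Fin d) ℝ :=
  (2⁻¹ * b ^ 2) • ((design D)ᵀ * design D)

/-- The parameter `b Xᵀ Y`. -/
def fbVector {d n : ℕ} (D : Data d n) (b : ℝ) : Vec d :=
  b • WithLp.toLp 2 ((design D)ᵀ *ᵥ response D)

/-- The minimization oracle, for the radii `b_1, …, b_N`: the Bayes estimator (posterior mean)
`∑ b_i ∂_γ C(2⁻¹ b_i² XᵀX, γ)|_{γ = b_i XᵀY} / ∑ C(2⁻¹ b_i² XᵀX, b_i XᵀY)`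
of the prior that draws one of the radii `b_i` uniformly and then a
uniform point of the sphere of radius `b_i`. -/
def fbEstimator {d n N : ℕ} (b : Fin N → ℝ) (D : Data d n) : Vec d :=
  (∑ i, fbConst (fbMatrix D (b i)) (fbVector D (b i)))⁻¹ •
    ∑ i, b i • ∇ (fun γ => fbConst (fbMatrix D (b i)) γ) (fbVector D (b i))

/-! ### The maximization oracle and the main loop -/

/-- The `K` uniformly spaced grid points `B/K, 2B/K, …, B` of `[0, B]`. -/
def gridPoint (B : ℝ) (K : ℕ) (j : Fin K) : ℝ := B * ((j : ℕ) + 1) / K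

/-- The regression vector `b e_1`. -/
def axisVec (d : ℕ) [NeZero d] (b : ℝ) : Vec d := b • EuclideanSpace.single (0 : Fin d) (1 : ℝ)

/-- The random inputs of one run of "draw the perturbation `σ`, then call the maximization
oracle": `σ` itself, and for every earlier iteration `i` and grid point `j` the `N₁` data sets
from which the oracle estimates `R(θ̂_i, b_j e_1)`. (In iteration `t` only `i < t` is read.) -/
abbrev CallSeed (d n T K N₁ : ℕ) : Type := ℝ × (Fin T × Fin K × Fin N₁ → Data d n)

/-- `σ ∼ Exp(η)`, and all the data sets are independent, those for the grid point `b_j` being drawn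
from the linear model with regression vector `b_j e_1`. -/
def callLaw (d n T K N₁ : ℕ) [NeZero d] (B η : ℝ) : Measure (CallSeed d n T K N₁) :=
  (expMeasure η).prod
    (Measure.pi fun q : Fin T × Fin K × Fin N₁ => dataLaw n (axisVec d (gridPoint B K q.2.1)))

/-- The random inputs of a whole run: in each of the `T` iterations the sampling step
is carried out `N₂` times. -/
abbrev Seeds (d n T K N₁ N₂ : ℕ) : Type := Fin T → Fin N₂ → CallSeed d n T K N₁

/-- All calls use fresh independent random inputs. -/
def seedsLaw (d n T K N₁ N₂ : ℕ) [NeZero d] (B η : ℝ) : Measure (Seeds d n T K N₁ N₂) :=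
  Measure.pi fun _ : Fin T => Measure.pi fun _ : Fin N₂ => callLaw d n T K N₁ B η

/-- The Monte Carlo estimate `(1/N₁) ∑_k ‖f(D_k) - θ‖²` of the risk of `f` at `θ`. -/
def empRisk {d n N₁ : ℕ} (f : Data d n → Vec d) (θ : Vec d) (D : Fin N₁ → Data d n) : ℝ :=
  (∑ k, ‖f (D k) - θ‖ ^ 2) / N₁

/-- A rule that returns the position of a largest entry (it only has a choice in case of ties). -/
def IsArgmaxRule {K : ℕ} (sel : (Fin K → ℝ) → Fin K) : Prop :=
  Measurable sel ∧ ∀ (v : Fin K → ℝ) (j : Fin K), v j ≤ v (sel v)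

/-- The (grid indices of the) radii sampled by the algorithm. For fixed `t`, and given the estimators
`θ̂_i` (`i < t`), the `N₂` radii are independent draws from the distribution `P_t` of the output
of the maximization oracle, which maximizes over the grid the estimate of
`∑_{i < t} R(θ̂_i, b e_1) + σ b`. Here `θ̂_i` is the output of the minimization
oracle for the radii sampled in iteration `i`. -/
def picks {d n T K N₁ N₂ : ℕ} [NeZero d] (B : ℝ) (sel : (Fin K → ℝ) → Fin K)
    (s : Seeds d n T K N₁ N₂) (t : Fin T) : Fin N₂ → Fin K := fun k =>
  sel fun j =>
    (∑ i : {i : Fin T // i < t},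
      empRisk (fbEstimator fun k' => gridPoint B K (picks B sel s i.1 k'))
        (axisVec d (gridPoint B K j)) (fun m => (s t k).2 (i.1, j, m)))
    + (s t k).1 * gridPoint B K j
termination_by t.val
decreasing_by exact i.2

/-- The radii `b_{t,1}, …, b_{t,N₂}` sampled from `P_t` in iteration `t`. -/
def radii {d n T K N₁ N₂ : ℕ} [NeZero d] (B : ℝ) (sel : (Fin K → ℝ) → Fin K)
    (s : Seeds d n T K N₁ N₂) (t : Fin T) (k : Fin N₂) : ℝ :=
  gridPoint B K (picks B sel s t k)

/-- The averaged estimator `θ̂_avg = (1/T) ∑_t θ̂_t`. -/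
def avgEstimator {d n T K N₁ N₂ : ℕ} [NeZero d] (B : ℝ) (sel : (Fin K → ℝ) → Fin K)
    (s : Seeds d n T K N₁ N₂) (D : Data d n) : Vec d :=
  (T : ℝ)⁻¹ • ∑ t, fbEstimator (radii B sel s t) D

/-- The uniform distribution on a finite list of reals. -/
def empMeasure {N : ℕ} (b : Fin N → ℝ) : Measure ℝ :=
  (N : ENNReal)⁻¹ • ∑ k, Measure.dirac (b k)

/-- The mixture `P̂_avg = (1/T) ∑_t P̂_t` of the empirical distributions of the sampled radii. -/
def avgPrior {d n T K N₁ N₂ : ℕ} [NeZero d] (B : ℝ) (sel : (Fin K → ℝ) → Fin K)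
    (s : Seeds d n T K N₁ N₂) : Measure ℝ :=
  (T : ENNReal)⁻¹ • ∑ t, empMeasure (radii B sel s t)

/-- The uniform probability distribution on the unit sphere. -/
def uniformSphere (d : ℕ) : Measure (sphere (0 : Vec d) 1) :=
  (surface d Set.univ)⁻¹ • surface d

/-- The radial extension to `ℝ^d` of a distribution of radii (the "density" proportional to
`‖θ‖^(1-d) Q(‖θ‖)`): draw a radius from `Q`, then a uniform point of the sphere of that radius. -/
def radialExtension (d : ℕ) (Q : Measure ℝ) : Measure (Vec d) :=
  (Q.prod (uniformSphere d)).map (fun p => p.1 • (p.2 : Vec d))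

end RegressionGame

end

noncomputable section

namespace RegressionGame

variable {d n : ℕ}

/-! Statistician and nature play a zero-sum game repeatedly. The statistician answers the sampled
prior `P̂_t` of each round with its Bayes estimator, hence has no regret; nature, restricted to
radii on a grid, follows the perturbed leader. Up to small errors, `sup_θ R(θ̂_avg, θ) ≤ max_j (1/T)
∑_t R(θ̂_t, b_j e₁) ≤ (1/T) ∑_t E_{b ∼ P_t} R(θ̂_t, b e₁) ≈ (1/T) ∑_t E_{b ∼ P̂_t} R(θ̂_t, b e₁) =
(1/T) ∑_t Bayes(P̂_t)`. The left end is at least `R*`. The right end is at most `R*` by weak duality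
and at most the Bayes risk of the averaged prior by concavity. Both claims follow on one event,
without a minimax theorem (`worstRisk_avgEstimator_le`).

First inequality: the squared loss is convex. A Bayes estimator for a radial prior is rotation
equivariant, so its risk depends on `‖θ‖` only. The risk is Lipschitz with constant `4 B (B √n +
1)`, because a Hellinger computation bounds the `L¹` distance of two data laws by `√n ‖θ - θ'‖`; so
the grid suffices.

Second inequality (`sum_risk_le_sum_pickProb`): in dimension one the leader moves monotonically with
the perturbation `σ`, and raising `σ` by twice the Lipschitz constant dominates the effect of one
more round. Stability of the leader thus reduces to the effect of a shift on an exponential law.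
Monte Carlo errors of the oracle enter through second moments only. The past is frozen here, so the
bound holds for every history and adaptivity does no harm.

Third step (`seedsLaw_exists_empFreq_ge_le`): given the earlier rounds, the `N₂` radii are i.i.d.
from `P_t`, and Hoeffding with a union bound over rounds and grid points gives the only exceptional
event. Last step: the Fisher–Bingham formula is the posterior mean (`fbEstimator_eq_posteriorMean`).
-/

/-! ### Likelihood ratios and the distance of two data laws -/

lemma gaussianReal_one_eq_withDensity (c : ℝ) :
    gaussianReal c 1 = (gaussianReal 0 1).withDensity
      (fun y => ENNReal.ofReal (Real.exp (y * c - c ^ 2 / 2))) := by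
  rw [gaussianReal_of_var_ne_zero _ one_ne_zero, gaussianReal_of_var_ne_zero _ one_ne_zero,
    ← withDensity_mul _ (measurable_gaussianPDF 0 1) (by fun_prop)]
  congr 1
  funext y
  simp only [Pi.mul_apply, gaussianPDF]
  rw [← ENNReal.ofReal_mul (gaussianPDFReal_nonneg _ _ _)]
  congr 1
  simp only [gaussianPDFReal, NNReal.coe_one]
  rw [mul_assoc (_⁻¹), ← Real.exp_add]
  congr 2
  ring

instance (θ : Vec d) : IsProbabilityMeasure (sampleLaw θ) :=
  Measure.isProbabilityMeasure_map (Measurable.aemeasurable (by fun_prop))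

instance (θ : Vec d) : IsProbabilityMeasure (dataLaw n θ) := by
  unfold dataLaw; infer_instance

/-- Given the covariate `x`, the response is `N(⟨x, θ⟩, 1)`. A common dominating law for all `θ` is
what later allows Fubini between data and prior. -/
lemma sampleLaw_eq_withDensity (θ : Vec d) :
    sampleLaw θ = (sampleLaw (0 : Vec d)).withDensity
      (fun p => ENNReal.ofReal (Real.exp (p.2 * inner ℝ p.1 θ - inner ℝ p.1 θ ^ 2 / 2))) := by
  refine Measure.ext_of_lintegral _ fun g hg => ?_
  rw [lintegral_withDensity_eq_lintegral_mul _ (by fun_prop) hg]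
  unfold sampleLaw
  rw [lintegral_map hg (by fun_prop), lintegral_map (by fun_prop) (by fun_prop),
    lintegral_prod _ (by fun_prop), lintegral_prod _ (by fun_prop)]
  refine lintegral_congr fun x => ?_
  have h1 : ∫⁻ y, g (x, inner ℝ x θ + y) ∂(gaussianReal 0 1) =
      ∫⁻ y, g (x, y) ∂(gaussianReal (inner ℝ x θ) 1) := by
    rw [← zero_add (inner ℝ x θ), ← gaussianReal_map_const_add, lintegral_map (by fun_prop)
      (by fun_prop), zero_add]
  rw [h1, gaussianReal_one_eq_withDensity,
    lintegral_withDensity_eq_lintegral_mul _ (by fun_prop) (by fun_prop)]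
  simp

/-- A product of densities is the density of the product measure. -/
lemma pi_withDensity {ι : Type*} [Fintype ι] {α : ι → Type*} [∀ i, MeasurableSpace (α i)]
    (μ : ∀ i, Measure (α i)) [∀ i, IsProbabilityMeasure (μ i)]
    (f : ∀ i, α i → ENNReal) (hf : ∀ i, Measurable (f i))
    [∀ i, SigmaFinite ((μ i).withDensity (f i))] :
    Measure.pi (fun i => (μ i).withDensity (f i)) =
      (Measure.pi μ).withDensity (fun x => ∏ i, f i (x i)) := by
  refine Measure.pi_eq fun s hs => ?_
  rw [withDensity_apply _ (MeasurableSet.univ_pi hs), ← lintegral_indicator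
    (MeasurableSet.univ_pi hs)]
  have h : (Set.univ.pi s).indicator (fun x => ∏ i, f i (x i)) =
      fun x => ∏ i, (s i).indicator (f i) (x i) := by
    classical
    funext x
    by_cases hx : x ∈ Set.univ.pi s
    · rw [Set.indicator_of_mem hx]
      exact Finset.prod_congr rfl fun i _ => (Set.indicator_of_mem (hx i (Set.mem_univ i)) _).symm
    · rw [Set.indicator_of_notMem hx]
      simp only [Set.mem_pi, Set.mem_univ, true_implies, not_forall] at hx
      obtain ⟨i, hi⟩ := hx
      exact (Finset.prod_eq_zero (Finset.mem_univ i) (Set.indicator_of_notMem hi _)).symm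
  rw [h, lintegral_prod_eq_prod_lintegral_of_indepFun Finset.univ
    (fun i (x : ∀ i, α i) => (s i).indicator (f i) (x i))
    (iIndepFun_pi (X := fun i => (s i).indicator (f i))
      fun i => ((hf i).indicator (hs i)).aemeasurable)
    fun i => ((hf i).indicator (hs i)).comp (measurable_pi_apply i)]
  refine Finset.prod_congr rfl fun i _ => ?_
  rw [withDensity_apply _ (hs i), ← lintegral_indicator (hs i)]
  exact (measurePreserving_eval μ i).lintegral_comp ((hf i).indicator (hs i))

/-- The logarithm of the likelihood ratio between the regression vectors `θ` and `0`. -/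
def logLik (D : Data d n) (θ : Vec d) : ℝ :=
  ∑ i, ((D i).2 * inner ℝ (D i).1 θ - inner ℝ (D i).1 θ ^ 2 / 2)

lemma continuous_logLik : Continuous fun p : Data d n × Vec d => logLik p.1 p.2 := by
  unfold logLik; fun_prop

lemma measurable_logLik (θ : Vec d) : Measurable fun D : Data d n => logLik D θ := by
  unfold logLik; fun_prop

lemma dataLaw_eq_withDensity (θ : Vec d) :
    dataLaw n θ = (dataLaw n (0 : Vec d)).withDensity
      (fun D => ENNReal.ofReal (Real.exp (logLik D θ))) := by
  unfold dataLaw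
  have : (fun _ : Fin n => sampleLaw θ) = fun _ : Fin n => (sampleLaw (0 : Vec d)).withDensity
      (fun p => ENNReal.ofReal (Real.exp (p.2 * inner ℝ p.1 θ - inner ℝ p.1 θ ^ 2 / 2))) := by
    funext _; exact sampleLaw_eq_withDensity θ
  rw [this]
  have : SigmaFinite ((sampleLaw (0 : Vec d)).withDensity
      (fun p => ENNReal.ofReal (Real.exp (p.2 * inner ℝ p.1 θ - inner ℝ p.1 θ ^ 2 / 2)))) := by
    rw [← sampleLaw_eq_withDensity]; infer_instance
  rw [pi_withDensity _ _ fun _ => by fun_prop]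
  congr 1
  funext D
  rw [← ENNReal.ofReal_prod_of_nonneg fun i _ => (Real.exp_pos _).le, ← Real.exp_sum]
  rfl

lemma integral_dataLaw {E : Type*} [NormedAddCommGroup E] [NormedSpace ℝ E]
    (g : Data d n → E) (θ : Vec d) :
    ∫ D, g D ∂(dataLaw n θ) = ∫ D, Real.exp (logLik D θ) • g D ∂(dataLaw n 0) := by
  rw [dataLaw_eq_withDensity, integral_withDensity_eq_integral_toReal_smul
    (by have := measurable_logLik (n := n) θ; fun_prop) (by simp)]
  simp [ENNReal.toReal_ofReal (Real.exp_pos _).le]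

lemma integrable_dataLaw_iff (g : Data d n → ℝ) (θ : Vec d) :
    Integrable g (dataLaw n θ) ↔
      Integrable (fun D => Real.exp (logLik D θ) * g D) (dataLaw n 0) := by
  rw [dataLaw_eq_withDensity, integrable_withDensity_iff
    (by have := measurable_logLik (n := n) θ; fun_prop) (by simp)]
  simp [ENNReal.toReal_ofReal (Real.exp_pos _).le, mul_comm]

lemma integrable_exp_logLik (θ : Vec d) :
    Integrable (fun D => Real.exp (logLik D θ)) (dataLaw n 0) := by
  simpa using (integrable_dataLaw_iff (n := n) (fun _ => (1 : ℝ)) θ).1 (integrable_const _)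

lemma integral_exp_logLik (θ : Vec d) :
    ∫ D, Real.exp (logLik D θ) ∂(dataLaw n 0) = 1 := by
  simpa using (integral_dataLaw (n := n) (fun _ => (1 : ℝ)) θ).symm

lemma integral_inner_sq_stdGaussian (v : Vec d) :
    Integrable (fun x => inner ℝ x v ^ 2) (stdGaussian (Vec d)) ∧
      ∫ x, inner ℝ x v ^ 2 ∂(stdGaussian (Vec d)) = ‖v‖ ^ 2 := by
  have hL : ∀ x : Vec d, inner ℝ x v = innerSL ℝ v x := fun x => by
    rw [innerSL_apply_apply, real_inner_comm]
  have hm : MemLp (fun x : Vec d => inner ℝ x v) 2 (stdGaussian (Vec d)) := by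
    simp_rw [hL]
    exact IsGaussian.memLp_dual _ _ _ (by simp)
  refine ⟨hm.integrable_sq, ?_⟩
  have h := variance_dual_stdGaussian (innerSL ℝ v)
  rw [variance_eq_integral (by fun_prop), integral_strongDual_stdGaussian,
    innerSL_apply_norm] at h
  rw [← h]
  simp [hL]

lemma integral_sum_inner_sq_dataLaw (θ v : Vec d) :
    Integrable (fun D : Data d n => ∑ i, inner ℝ (D i).1 v ^ 2) (dataLaw n θ) ∧
      ∫ D : Data d n, ∑ i, inner ℝ (D i).1 v ^ 2 ∂(dataLaw n θ) = n * ‖v‖ ^ 2 := by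
  have hmap : (sampleLaw θ).map Prod.fst = stdGaussian (Vec d) := by
    unfold sampleLaw
    rw [Measure.map_map (by fun_prop) (by fun_prop)]
    exact Measure.fst_prod
  have hp : ∀ i : Fin n, MeasurePreserving (fun D : Data d n => (D i).1) (dataLaw n θ)
      (stdGaussian (Vec d)) := fun i =>
    (⟨measurable_fst, hmap⟩ : MeasurePreserving Prod.fst (sampleLaw θ) _).comp
      (measurePreserving_eval (fun _ : Fin n => sampleLaw θ) i)
  have hi : ∀ i : Fin n, Integrable (fun D : Data d n => inner ℝ (D i).1 v ^ 2) (dataLaw n θ) :=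
    fun i => (hp i).integrable_comp_of_integrable (integral_inner_sq_stdGaussian v).1
  refine ⟨integrable_finsetSum _ fun i _ => hi i, ?_⟩
  rw [integral_finsetSum _ fun i _ => hi i]
  have : ∀ i : Fin n, ∫ D : Data d n, inner ℝ (D i).1 v ^ 2 ∂(dataLaw n θ) = ‖v‖ ^ 2 := fun i => by
    rw [← (integral_inner_sq_stdGaussian v).2, ← (hp i).map_eq, integral_map
      (hp i).measurable.aemeasurable (by fun_prop)]
  simp [this]

/-- The Hellinger affinity integrand in terms of the likelihood at the midpoint. -/
lemma exp_logLik_mul (D : Data d n) (θ θ' : Vec d) :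
    Real.exp (logLik D θ / 2) * Real.exp (logLik D θ' / 2) =
      Real.exp (logLik D ((2⁻¹ : ℝ) • (θ + θ'))) *
        Real.exp (-((∑ i, inner ℝ (D i).1 (θ - θ') ^ 2) / 8)) := by
  rw [← Real.exp_add, ← Real.exp_add]
  congr 1
  unfold logLik
  rw [Finset.sum_div, Finset.sum_div, Finset.sum_div, ← Finset.sum_neg_distrib,
    ← Finset.sum_add_distrib, ← Finset.sum_add_distrib]
  refine Finset.sum_congr rfl fun i _ => ?_
  -- Parallelogram identity: `(a² + b²)/4 = ((a + b)/2)²/2 + (a - b)²/8`.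
  rw [inner_smul_right, inner_add_right, inner_sub_right]
  ring

/-- The affinity is the mean, under the law of the midpoint, of `exp (-q/8)` with `q` of mean `n ‖θ
- θ'‖²`; then `1 - y ≤ exp (-y)`. -/
lemma hellinger_affinity (θ θ' : Vec d) :
    Integrable (fun D : Data d n => Real.exp (logLik D θ / 2) * Real.exp (logLik D θ' / 2))
      (dataLaw n 0) ∧
    1 - n * ‖θ - θ'‖ ^ 2 / 8 ≤
      ∫ D : Data d n, Real.exp (logLik D θ / 2) * Real.exp (logLik D θ' / 2) ∂(dataLaw n 0) := by
  simp_rw [exp_logLik_mul]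
  set m : Vec d := (2⁻¹ : ℝ) • (θ + θ')
  obtain ⟨h1, h2⟩ := integral_sum_inner_sq_dataLaw (n := n) m (θ - θ')
  have hi : Integrable (fun D : Data d n => Real.exp (-((∑ i, inner ℝ (D i).1 (θ - θ') ^ 2) / 8)))
      (dataLaw n m) := by
    refine Integrable.of_bound (C := 1)
      (Measurable.aestronglyMeasurable (by fun_prop)) (Filter.Eventually.of_forall fun D => ?_)
    rw [Real.norm_eq_abs, abs_of_pos (Real.exp_pos _), Real.exp_le_one_iff, neg_nonpos]
    positivity
  refine ⟨(integrable_dataLaw_iff _ _).1 hi, ?_⟩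
  have := integral_dataLaw (n := n)
    (fun D => Real.exp (-((∑ i, inner ℝ (D i).1 (θ - θ') ^ 2) / 8))) m
  simp only [smul_eq_mul] at this
  rw [← this]
  calc 1 - n * ‖θ - θ'‖ ^ 2 / 8
      = ∫ D : Data d n, (1 - (∑ i, inner ℝ (D i).1 (θ - θ') ^ 2) / 8) ∂(dataLaw n m) := by
        rw [integral_sub (integrable_const _) (h1.div_const _), integral_div, h2]; simp
    _ ≤ _ := by
        refine integral_mono ((integrable_const _).sub (h1.div_const _)) hi fun D => ?_
        have := Real.add_one_le_exp (-((∑ i, inner ℝ (D i).1 (θ - θ') ^ 2) / 8))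
        simp only
        linarith

/-- The total variation distance of two data laws. -/
lemma integral_abs_exp_logLik_sub_le (θ θ' : Vec d) :
    ∫ D : Data d n, |Real.exp (logLik D θ) - Real.exp (logLik D θ')| ∂(dataLaw n 0) ≤
      √n * ‖θ - θ'‖ := by
  rcases eq_or_ne (√(n : ℝ) * ‖θ - θ'‖) 0 with h0 | h0
  · rw [h0]
    rcases mul_eq_zero.1 h0 with h | h
    · have hn : n = 0 := by
        rw [Real.sqrt_eq_zero (Nat.cast_nonneg n)] at h; exact_mod_cast h
      subst hn
      simp [logLik]
    · rw [norm_eq_zero, sub_eq_zero] at h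
      simp [h]
  have hr : 0 < √(n : ℝ) * ‖θ - θ'‖ := lt_of_le_of_ne (by positivity) h0.symm
  set r := √(n : ℝ) * ‖θ - θ'‖ with hrdef
  have hr2 : n * ‖θ - θ'‖ ^ 2 = r ^ 2 := by
    rw [hrdef, mul_pow, Real.sq_sqrt (Nat.cast_nonneg n)]
  obtain ⟨hi, hb⟩ := hellinger_affinity (n := n) θ θ'
  rw [hr2] at hb
  have e1 := integral_exp_logLik (n := n) θ
  have e2 := integral_exp_logLik (n := n) θ'
  have i1 := integrable_exp_logLik (n := n) θ
  have i2 := integrable_exp_logLik (n := n) θ'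
  have i12 : Integrable (fun D : Data d n => Real.exp (logLik D θ) + Real.exp (logLik D θ'))
    (dataLaw n 0) := i1.add i2
  set A := ∫ D : Data d n, Real.exp (logLik D θ / 2) * Real.exp (logLik D θ' / 2) ∂(dataLaw n 0)
  have hA : A ≤ 1 := by
    have : A ≤ ∫ D : Data d n, (Real.exp (logLik D θ) + Real.exp (logLik D θ')) / 2
        ∂(dataLaw n 0) := by
      refine integral_mono hi (i12.div_const _) fun D => ?_
      have := two_mul_le_add_sq (Real.exp (logLik D θ / 2)) (Real.exp (logLik D θ' / 2))
      rw [← Real.exp_nat_mul, ← Real.exp_nat_mul] at this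
      simp only [Nat.cast_ofNat, mul_div_cancel₀ _ (two_ne_zero (α := ℝ))] at this
      simp only
      linarith
    rw [integral_div, integral_add i1 i2, e1, e2] at this
    linarith
  -- Weighted AM–GM replaces Cauchy–Schwarz: with `s`, `t` the square roots of the likelihoods, `|s²
  -- - t²| ≤ (2/r)(s - t)² + (r/8)(s + t)²`. The two squares integrate to `2 - 2A ≤ r²/4` and `2 +
  -- 2A ≤ 4`, so each term contributes at most `r/2`.
  calc ∫ D : Data d n, |Real.exp (logLik D θ) - Real.exp (logLik D θ')| ∂(dataLaw n 0)
      ≤ ∫ D : Data d n, ((2 / r + r / 8) * (Real.exp (logLik D θ) + Real.exp (logLik D θ')) +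
          (r / 4 - 4 / r) *
            (Real.exp (logLik D θ / 2) * Real.exp (logLik D θ' / 2))) ∂(dataLaw n 0) := by
        refine integral_mono (i1.sub i2).abs ((i12.const_mul _).add (hi.const_mul _)) fun D => ?_
        have hs : ∀ x : ℝ, Real.exp x = Real.exp (x / 2) ^ 2 := fun x => by
          rw [← Real.exp_nat_mul]; congr 1; push_cast; ring
        simp only [hs (logLik D θ), hs (logLik D θ')]
        set s := Real.exp (logLik D θ / 2)
        set t := Real.exp (logLik D θ' / 2)
        have key : ∀ u v : ℝ, |u * v| ≤ 2 / r * u ^ 2 + r / 8 * v ^ 2 := fun u v => by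
          have h1 : 2 / r * u ^ 2 + r / 8 * v ^ 2 - u * v = 2 / r * (u - r / 4 * v) ^ 2 := by
            field_simp; ring
          have h2 : 2 / r * u ^ 2 + r / 8 * v ^ 2 + u * v = 2 / r * (u + r / 4 * v) ^ 2 := by
            field_simp; ring
          have h3 : 0 ≤ 2 / r * (u - r / 4 * v) ^ 2 := by positivity
          have h4 : 0 ≤ 2 / r * (u + r / 4 * v) ^ 2 := by positivity
          exact abs_le.2 ⟨by linarith, by linarith⟩
        have := key (s - t) (s + t)
        calc |s ^ 2 - t ^ 2| = |(s - t) * (s + t)| := by congr 1; ring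
          _ ≤ _ := this
          _ = _ := by ring
    _ ≤ r := by
        rw [integral_add (i12.const_mul _) (hi.const_mul _), integral_const_mul,
          integral_const_mul, integral_add i1 i2, e1, e2]
        have h1 : 4 / r * (1 - A) ≤ 4 / r * (r ^ 2 / 8) :=
          mul_le_mul_of_nonneg_left (by linarith) (by positivity)
        have h2 : 4 / r * (r ^ 2 / 8) = r / 2 := by field_simp; ring
        have h3 : r / 4 * A ≤ r / 4 * 1 := mul_le_mul_of_nonneg_left hA (by positivity)
        have h4 : (2 / r + r / 8) * (1 + 1) + (r / 4 - 4 / r) * A =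
          r / 4 + r / 4 * A + 4 / r * (1 - A) := by ring
        linarith

/-! ### Boundedness and Lipschitz continuity of the risk -/

lemma norm_sub_le_two_mul {B : ℝ} {a b : Vec d} (ha : a ∈ closedBall (0 : Vec d) B)
    (hb : b ∈ closedBall (0 : Vec d) B) : ‖a - b‖ ≤ 2 * B := by
  rw [mem_closedBall_zero_iff] at ha hb
  linarith [norm_sub_le a b]

lemma norm_sub_sq_le {B : ℝ} {a b : Vec d} (ha : a ∈ closedBall (0 : Vec d) B)
    (hb : b ∈ closedBall (0 : Vec d) B) : ‖a - b‖ ^ 2 ≤ 4 * B ^ 2 := by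
  have := pow_le_pow_left₀ (norm_nonneg _) (norm_sub_le_two_mul ha hb) 2
  linarith

lemma IsEstimator.measurable_loss {B : ℝ} {f : Data d n → Vec d} (hf : IsEstimator B f)
    (θ : Vec d) : Measurable fun D => ‖f D - θ‖ ^ 2 := by
  have := hf.1
  fun_prop

lemma IsEstimator.integrable_loss {B : ℝ} {f : Data d n → Vec d} (hf : IsEstimator B f)
    {θ : Vec d} (hθ : θ ∈ closedBall (0 : Vec d) B) (μ : Measure (Data d n)) [IsFiniteMeasure μ] :
    Integrable (fun D => ‖f D - θ‖ ^ 2) μ :=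
  Integrable.of_bound (C := 4 * B ^ 2) (hf.measurable_loss θ).aestronglyMeasurable
    (Filter.Eventually.of_forall fun D => by
      rw [Real.norm_eq_abs, abs_of_nonneg (sq_nonneg _)]
      exact norm_sub_sq_le (hf.2 D) hθ)

lemma risk_nonneg (f : Data d n → Vec d) (θ : Vec d) : 0 ≤ risk f θ :=
  integral_nonneg fun _ => sq_nonneg _

lemma IsEstimator.risk_le {B : ℝ} {f : Data d n → Vec d} (hf : IsEstimator B f)
    {θ : Vec d} (hθ : θ ∈ closedBall (0 : Vec d) B) : risk f θ ≤ 4 * B ^ 2 := by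
  have := integral_mono (hf.integrable_loss hθ (dataLaw n θ)) (integrable_const (4 * B ^ 2))
    fun D => norm_sub_sq_le (hf.2 D) hθ
  simpa [risk] using this

/-- Moving `θ` changes the loss by at most `4B ‖θ - θ'‖` and the law by at most `√n ‖θ - θ'‖` in
`L¹`, against a loss of size at most `4B²`. -/
lemma IsEstimator.risk_sub_le {B : ℝ} {f : Data d n → Vec d} (hf : IsEstimator B f)
    {θ θ' : Vec d} (hθ : θ ∈ closedBall (0 : Vec d) B) (hθ' : θ' ∈ closedBall (0 : Vec d) B) :
    risk f θ - risk f θ' ≤ 4 * (B * (B * √n + 1)) * ‖θ - θ'‖ := by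
  have i1 := (integrable_dataLaw_iff _ _).1 (hf.integrable_loss hθ (dataLaw n θ))
  have i2 := (integrable_dataLaw_iff _ _).1 (hf.integrable_loss hθ' (dataLaw n θ'))
  have j1 := integrable_exp_logLik (n := n) θ
  have j2 := (j1.sub (integrable_exp_logLik (n := n) θ')).abs
  simp only [Pi.sub_apply] at j2
  unfold risk
  rw [integral_dataLaw _ θ, integral_dataLaw _ θ']
  simp only [smul_eq_mul]
  rw [← integral_sub i1 i2]
  calc ∫ D, (Real.exp (logLik D θ) * ‖f D - θ‖ ^ 2 - Real.exp (logLik D θ') * ‖f D - θ'‖ ^ 2)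
        ∂(dataLaw n 0)
      ≤ ∫ D, (Real.exp (logLik D θ) * (4 * B * ‖θ - θ'‖) +
          |Real.exp (logLik D θ) - Real.exp (logLik D θ')| * (4 * B ^ 2)) ∂(dataLaw n 0) := by
        refine integral_mono (i1.sub i2) ((j1.mul_const _).add (j2.mul_const _)) fun D => ?_
        have h1 : ‖f D - θ‖ ^ 2 - ‖f D - θ'‖ ^ 2 ≤ 4 * B * ‖θ - θ'‖ := by
          have a1 := norm_sub_le_two_mul (hf.2 D) hθ
          have a2 := norm_sub_le_two_mul (hf.2 D) hθ'
          have a3 : ‖f D - θ‖ - ‖f D - θ'‖ ≤ ‖θ - θ'‖ := by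
            have := norm_sub_norm_le (f D - θ) (f D - θ')
            rwa [sub_sub_sub_cancel_left, norm_sub_rev θ'] at this
          nlinarith [norm_nonneg (f D - θ), norm_nonneg (f D - θ'), norm_nonneg (θ - θ')]
        have h2 : (Real.exp (logLik D θ) - Real.exp (logLik D θ')) * ‖f D - θ'‖ ^ 2 ≤
            |Real.exp (logLik D θ) - Real.exp (logLik D θ')| * (4 * B ^ 2) :=
          mul_le_mul (le_abs_self _) (norm_sub_sq_le (hf.2 D) hθ') (sq_nonneg _) (abs_nonneg _)
        have h3 := mul_le_mul_of_nonneg_left h1 (Real.exp_pos (logLik D θ)).le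
        simp only
        linarith
    _ = 4 * B * ‖θ - θ'‖ + 4 * B ^ 2 *
          ∫ D, |Real.exp (logLik D θ) - Real.exp (logLik D θ')| ∂(dataLaw n 0) := by
        rw [integral_add (j1.mul_const _) (j2.mul_const _), integral_mul_const,
          integral_mul_const, integral_exp_logLik]
        ring
    _ ≤ 4 * B * ‖θ - θ'‖ + 4 * B ^ 2 * (√n * ‖θ - θ'‖) := by
        gcongr
        exact integral_abs_exp_logLik_sub_le θ θ'
    _ = _ := by ring

lemma IsEstimator.abs_risk_sub_le {B : ℝ} {f : Data d n → Vec d} (hf : IsEstimator B f)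
    {θ θ' : Vec d} (hθ : θ ∈ closedBall (0 : Vec d) B) (hθ' : θ' ∈ closedBall (0 : Vec d) B) :
    |risk f θ - risk f θ'| ≤ 4 * (B * (B * √n + 1)) * ‖θ - θ'‖ := by
  refine abs_le.2 ⟨?_, hf.risk_sub_le hθ hθ'⟩
  have := hf.risk_sub_le hθ' hθ
  rw [norm_sub_rev] at this
  linarith

lemma IsEstimator.continuousOn_risk {B : ℝ} {f : Data d n → Vec d} (hf : IsEstimator B f) :
    ContinuousOn (risk f) (closedBall 0 B) := by
  have h : LipschitzOnWith (4 * (B * (B * √n + 1))).toNNReal (risk f) (closedBall 0 B) :=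
    LipschitzOnWith.of_dist_le_mul fun θ hθ θ' hθ' => by
      rw [Real.dist_eq, dist_eq_norm]
      exact (hf.abs_risk_sub_le hθ hθ').trans
        (mul_le_mul_of_nonneg_right (Real.le_coe_toNNReal _) (norm_nonneg _))
  exact h.continuousOn

lemma IsEstimator.mono {A B : ℝ} {f : Data d n → Vec d} (hf : IsEstimator B f) (h : B ≤ A) :
    IsEstimator A f :=
  ⟨hf.1, fun D => closedBall_subset_closedBall h (hf.2 D)⟩

/-- An estimator for the radius `B` is one for every larger radius, so the Lipschitz bound is
available near any point of the space. -/
lemma IsEstimator.continuous_risk {B : ℝ} {f : Data d n → Vec d} (hf : IsEstimator B f) :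
    Continuous (risk f) := by
  refine continuous_iff_continuousAt.2 fun θ => ?_
  refine ((hf.mono (le_max_left B (‖θ‖ + 1))).continuousOn_risk).continuousAt ?_
  refine Filter.mem_of_superset (ball_mem_nhds θ one_pos) fun x hx => ?_
  rw [mem_ball, dist_eq_norm] at hx
  rw [mem_closedBall_zero_iff]
  have := norm_le_norm_add_norm_sub' x θ
  exact le_trans (by linarith) (le_max_right _ _)

/-! Invariance under rotations -/

/-- The action of a linear isometry on the covariates of a data set. -/
def rotateData (U : Vec d ≃ₗᵢ[ℝ] Vec d) (D : Data d n) : Data d n := fun i => (U (D i).1, (D i).2)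

lemma measurable_rotateData (U : Vec d ≃ₗᵢ[ℝ] Vec d) :
    Measurable (rotateData U : Data d n → Data d n) := by
  have := U.continuous
  unfold rotateData; fun_prop

lemma logLik_rotateData (U : Vec d ≃ₗᵢ[ℝ] Vec d) (D : Data d n) (θ : Vec d) :
    logLik (rotateData U D) (U θ) = logLik D θ := by
  simp [logLik, rotateData]

lemma sampleLaw_map (U : Vec d ≃ₗᵢ[ℝ] Vec d) (θ : Vec d) :
    (sampleLaw θ).map (Prod.map U id) = sampleLaw (U θ) := by
  have hU := U.continuous.measurable
  unfold sampleLaw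
  have h : (stdGaussian (Vec d)).prod (gaussianReal 0 1) =
      ((stdGaussian (Vec d)).prod (gaussianReal 0 1)).map (Prod.map U id) := by
    rw [← Measure.map_prod_map _ _ hU measurable_id, stdGaussian_map, Measure.map_id]
  conv_rhs => rw [h]
  rw [Measure.map_map (hU.prodMap measurable_id) (by fun_prop),
    Measure.map_map (by fun_prop) (hU.prodMap measurable_id)]
  congr 1
  funext p
  simp

lemma dataLaw_map (U : Vec d ≃ₗᵢ[ℝ] Vec d) (θ : Vec d) :
    (dataLaw n θ).map (rotateData U) = dataLaw n (U θ) := by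
  have hU : Measurable (Prod.map U id : Vec d × ℝ → Vec d × ℝ) :=
    U.continuous.measurable.prodMap measurable_id
  have h : ∀ _ : Fin n, SigmaFinite ((sampleLaw θ).map (Prod.map U id)) := fun _ => by
    rw [sampleLaw_map]; infer_instance
  unfold dataLaw
  rw [← sampleLaw_map, ← Measure.pi_map_pi fun _ => hU.aemeasurable]
  rfl

lemma risk_map_of_equivariant {f : Data d n → Vec d} (hf : Measurable f)
    (U : Vec d ≃ₗᵢ[ℝ] Vec d) (h : ∀ D, f (rotateData U D) = U (f D)) (θ : Vec d) :
    risk f (U θ) = risk f θ := by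
  unfold risk
  rw [← dataLaw_map, integral_map (measurable_rotateData U).aemeasurable
    (Measurable.aestronglyMeasurable (by fun_prop))]
  simp_rw [h, ← map_sub, LinearIsometryEquiv.norm_map]

/-- Two vectors of the same norm are related by a linear isometry. -/
lemma exists_linearIsometryEquiv_apply_eq {v w : Vec d} (h : ‖v‖ = ‖w‖) :
    ∃ U : Vec d ≃ₗᵢ[ℝ] Vec d, U v = w :=
  ⟨_, Submodule.reflection_sub h⟩

/-! ### Rotation invariance of the sphere measure and of radial priors -/

instance : IsFiniteMeasure (surface d) := by unfold surface; infer_instance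

/-- The action of a linear isometry on the unit sphere. -/
def rotateSphere (U : Vec d ≃ₗᵢ[ℝ] Vec d) (Z : sphere (0 : Vec d) 1) : sphere (0 : Vec d) 1 :=
  ⟨U Z, by simp⟩

lemma measurable_rotateSphere (U : Vec d ≃ₗᵢ[ℝ] Vec d) : Measurable (rotateSphere U) :=
  (U.continuous.measurable.comp measurable_subtype_coe).subtype_mk

open scoped Pointwise in
-- The surface measure of a set is, up to a factor, the volume of the cone over it; cones are
-- carried to cones by `U`, which preserves volume.
lemma surface_map (U : Vec d ≃ₗᵢ[ℝ] Vec d) : (surface d).map (rotateSphere U) = surface d := by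
  ext s hs
  rw [Measure.map_apply (measurable_rotateSphere U) hs]
  unfold surface
  rw [Measure.toSphere_apply' _ (measurable_rotateSphere U hs), Measure.toSphere_apply' _ hs]
  congr 1
  have h1 : (Set.Ioo (0 : ℝ) 1 • ((↑) '' (rotateSphere U ⁻¹' s)) : Set (Vec d)) =
      U ⁻¹' (Set.Ioo (0 : ℝ) 1 • ((↑) '' s)) := by
    ext x
    simp only [Set.mem_smul, Set.mem_image, Set.mem_preimage]
    constructor
    · rintro ⟨r, hr, _, ⟨Z, hZ, rfl⟩, rfl⟩
      exact ⟨r, hr, _, ⟨_, hZ, rfl⟩, by simp [rotateSphere]⟩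
    · rintro ⟨r, hr, _, ⟨Z, hZ, rfl⟩, hx⟩
      refine ⟨r, hr, _, ⟨rotateSphere U.symm Z, ?_, rfl⟩, ?_⟩
      · convert hZ
        ext1
        simp [rotateSphere]
      · simp only [rotateSphere]
        rw [← map_smul, hx, LinearIsometryEquiv.symm_apply_apply]
  rw [h1]
  have := U.measurePreserving.map_eq
  conv_rhs => rw [← this]
  exact (U.toHomeomorph.toMeasurableEquiv.map_apply _).symm

lemma uniformSphere_map (U : Vec d ≃ₗᵢ[ℝ] Vec d) :
    (uniformSphere d).map (rotateSphere U) = uniformSphere d := by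
  unfold uniformSphere
  rw [Measure.map_smul, surface_map]

lemma surface_univ_ne_zero [NeZero d] : surface d Set.univ ≠ 0 := by
  have : Nontrivial (Vec d) := by
    have : Nonempty (Fin d) := ⟨0⟩
    infer_instance
  rw [Ne, Measure.measure_univ_eq_zero]
  exact Measure.toSphere_ne_zero _

instance [NeZero d] : IsProbabilityMeasure (uniformSphere d) := by
  refine ⟨?_⟩
  simp only [uniformSphere, Measure.smul_apply, smul_eq_mul]
  exact ENNReal.inv_mul_cancel surface_univ_ne_zero (measure_ne_top _ _)

lemma measurable_smul_sphere :
    Measurable fun p : ℝ × sphere (0 : Vec d) 1 => p.1 • (p.2 : Vec d) :=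
  Continuous.measurable (by fun_prop)

instance [NeZero d] (Q : Measure ℝ) [IsProbabilityMeasure Q] :
    IsProbabilityMeasure (radialExtension d Q) :=
  Measure.isProbabilityMeasure_map measurable_smul_sphere.aemeasurable

lemma radialExtension_map [NeZero d] (Q : Measure ℝ) [SFinite Q] (U : Vec d ≃ₗᵢ[ℝ] Vec d) :
    (radialExtension d Q).map U = radialExtension d Q := by
  have hU := U.continuous.measurable
  have hR := measurable_rotateSphere U
  have h : Q.prod (uniformSphere d) =
      (Q.prod (uniformSphere d)).map (Prod.map id (rotateSphere U)) := by
    rw [← Measure.map_prod_map _ _ measurable_id hR, uniformSphere_map, Measure.map_id]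
  unfold radialExtension
  conv_rhs => rw [h]
  rw [Measure.map_map hU measurable_smul_sphere,
    Measure.map_map measurable_smul_sphere (measurable_id.prodMap hR)]
  congr 1
  funext p
  simp [rotateSphere]

lemma radialExtension_sum [NeZero d] {ι : Type*} [Fintype ι] (Q : ι → Measure ℝ) :
    radialExtension d (∑ i, Q i) = ∑ i, radialExtension d (Q i) := by
  unfold radialExtension
  rw [← Measure.map_finset_sum measurable_smul_sphere.aemeasurable, ← Measure.sum_fintype,
    Measure.prod_sum_left, Measure.sum_fintype]

lemma radialExtension_smul [NeZero d] (c : ENNReal) (Q : Measure ℝ) [SFinite Q] :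
    radialExtension d (c • Q) = c • radialExtension d Q := by
  unfold radialExtension
  rw [Measure.prod_smul_left, Measure.map_smul]

lemma radialExtension_dirac [NeZero d] (r : ℝ) :
    radialExtension d (Measure.dirac r) =
      (uniformSphere d).map fun Z : sphere (0 : Vec d) 1 => r • (Z : Vec d) := by
  unfold radialExtension
  rw [Measure.dirac_prod, Measure.map_map measurable_smul_sphere (by fun_prop)]
  rfl

lemma integrable_sphere {E : Type*} [NormedAddCommGroup E] {g : sphere (0 : Vec d) 1 → E}
    (hg : Continuous g) (μ : Measure (sphere (0 : Vec d) 1)) [IsFiniteMeasure μ] :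
    Integrable g μ :=
  hg.integrable_of_hasCompactSupport (HasCompactSupport.of_compactSpace g)

lemma integrable_radialExtension_dirac [NeZero d] {E : Type*} [NormedAddCommGroup E]
    {g : Vec d → E} (hg : Continuous g) (r : ℝ) :
    Integrable g (radialExtension d (Measure.dirac r)) := by
  rw [radialExtension_dirac, integrable_map_measure
    hg.aestronglyMeasurable (by fun_prop)]
  exact integrable_sphere (by fun_prop) _

lemma integral_radialExtension_dirac [NeZero d] {E : Type*} [NormedAddCommGroup E]
    [NormedSpace ℝ E] {g : Vec d → E} (hg : Continuous g) (r : ℝ) :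
    ∫ θ, g θ ∂(radialExtension d (Measure.dirac r)) =
      ∫ Z : sphere (0 : Vec d) 1, g (r • (Z : Vec d)) ∂(uniformSphere d) := by
  rw [radialExtension_dirac, integral_map (by fun_prop) hg.aestronglyMeasurable]

lemma radialExtension_empMeasure [NeZero d] {N : ℕ} (b : Fin N → ℝ) :
    radialExtension d (empMeasure b) =
      (N : ENNReal)⁻¹ • ∑ k, radialExtension d (Measure.dirac (b k)) := by
  unfold empMeasure
  rw [radialExtension_smul, radialExtension_sum]

lemma integrable_radialExtension_empMeasure [NeZero d] {E : Type*} [NormedAddCommGroup E]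
    {N : ℕ} (hN : N ≠ 0) (b : Fin N → ℝ) {g : Vec d → E} (hg : Continuous g) :
    Integrable g (radialExtension d (empMeasure b)) := by
  rw [radialExtension_empMeasure]
  exact (integrable_finsetSum_measure.2 fun k _ =>
    integrable_radialExtension_dirac hg (b k)).smul_measure (by simpa using hN)

lemma integral_radialExtension_empMeasure [NeZero d] {E : Type*} [NormedAddCommGroup E]
    [NormedSpace ℝ E] {N : ℕ} (b : Fin N → ℝ) {g : Vec d → E} (hg : Continuous g) :
    ∫ θ, g θ ∂(radialExtension d (empMeasure b)) =
      (N : ℝ)⁻¹ • ∑ k, ∫ Z : sphere (0 : Vec d) 1, g (b k • (Z : Vec d)) ∂(uniformSphere d) := by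
  rw [radialExtension_empMeasure, integral_smul_measure,
    integral_finsetSum_measure fun k _ => integrable_radialExtension_dirac hg (b k)]
  simp_rw [integral_radialExtension_dirac hg]
  simp

lemma isProbabilityMeasure_empMeasure {N : ℕ} (hN : N ≠ 0) (b : Fin N → ℝ) :
    IsProbabilityMeasure (empMeasure b) := by
  refine ⟨?_⟩
  simp only [empMeasure, Measure.smul_apply, Measure.finsetSum_apply, measure_univ]
  simp [ENNReal.inv_mul_cancel, hN]

lemma ae_mem_radialExtension_empMeasure [NeZero d] {B : ℝ} {N : ℕ} {b : Fin N → ℝ}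
    (hb : ∀ k, |b k| ≤ B) :
    ∀ᵐ θ ∂(radialExtension d (empMeasure b)), θ ∈ closedBall (0 : Vec d) B := by
  rw [radialExtension_empMeasure]
  refine Measure.ae_smul_measure ?_ _
  rw [ae_finsetSum_measure_iff]
  intro k _
  rw [radialExtension_dirac]
  refine (ae_map_iff (by fun_prop) (measurableSet_closedBall (x := (0 : Vec d)) (ε := B))).2 ?_
  refine Filter.Eventually.of_forall fun Z => ?_
  rw [dist_zero_right, norm_smul]
  simpa using hb k

/-! The minimization oracle is the posterior mean -/

lemma design_mulVec (D : Data d n) (v : Vec d) (i : Fin n) :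
    (design D *ᵥ v.ofLp) i = inner ℝ (D i).1 v := by
  rw [EuclideanSpace.inner_eq_star_dotProduct, dotProduct_comm]
  simp only [star_trivial]
  rfl

/-- Hence `fbConst` is the likelihood integrated over the sphere of radius `b`, and its gradient in
`γ` inserts the factor `Z`, that is `θ / b` when `b ≠ 0`. -/
lemma fb_exponent_eq_logLik (D : Data d n) (b : ℝ) (v : Vec d) :
    -(v.ofLp ⬝ᵥ (fbMatrix D b *ᵥ v.ofLp)) + inner ℝ (fbVector D b) v = logLik D (b • v) := by
  have h1 : v.ofLp ⬝ᵥ (fbMatrix D b *ᵥ v.ofLp) =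
      2⁻¹ * b ^ 2 * ∑ i, inner ℝ (D i).1 v ^ 2 := by
    rw [fbMatrix, smul_mulVec, dotProduct_smul, ← mulVec_mulVec, dotProduct_mulVec,
      vecMul_transpose, smul_eq_mul]
    congr 1
    simp only [dotProduct, design_mulVec, sq]
  have h2 : inner ℝ (fbVector D b) v = b * ∑ i, (D i).2 * inner ℝ (D i).1 v := by
    rw [fbVector, real_inner_smul_left, EuclideanSpace.inner_eq_star_dotProduct]
    simp only [star_trivial]
    rw [dotProduct_mulVec, vecMul_transpose, dotProduct_comm]
    congr 1
    simp only [dotProduct, design_mulVec, response]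
  rw [h1, h2, logLik, Finset.mul_sum, Finset.mul_sum, ← Finset.sum_neg_distrib,
    ← Finset.sum_add_distrib]
  refine Finset.sum_congr rfl fun i _ => ?_
  rw [inner_smul_right]
  ring

/-- Differentiation under the integral sign; since `‖Z‖ = 1`, the integrand's gradient is dominated
uniformly for `γ` in a unit ball. -/
lemma hasGradientAt_fbConst (A : Matrix (Fin d) (Fin d) ℝ) (γ : Vec d) :
    HasGradientAt (fun γ => fbConst A γ)
      (∫ Z : sphere (0 : Vec d) 1, Real.exp (-((Z : Vec d).ofLp ⬝ᵥ (A *ᵥ (Z : Vec d).ofLp)) +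
        inner ℝ γ (Z : Vec d)) • (Z : Vec d) ∂(surface d)) γ := by
  set q : sphere (0 : Vec d) 1 → ℝ := fun Z => -((Z : Vec d).ofLp ⬝ᵥ (A *ᵥ (Z : Vec d).ofLp))
    with hq
  have hqc : Continuous q := by
    simp only [hq, dotProduct, mulVec]
    fun_prop
  rw [hasGradientAt_iff_hasFDerivAt]
  have hF : ∀ x : Vec d, Continuous fun Z : sphere (0 : Vec d) 1 =>
      Real.exp (q Z + inner ℝ x (Z : Vec d)) := fun x => by fun_prop
  have key := hasFDerivAt_integral_of_dominated_of_fderiv_le (𝕜 := ℝ) (μ := surface d)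
    (F := fun (x : Vec d) (Z : sphere (0 : Vec d) 1) => Real.exp (q Z + inner ℝ x (Z : Vec d)))
    (F' := fun (x : Vec d) (Z : sphere (0 : Vec d) 1) =>
      InnerProductSpace.toDual ℝ (Vec d)
        (Real.exp (q Z + inner ℝ x (Z : Vec d)) • (Z : Vec d)))
    (x₀ := γ) (s := ball γ 1) (bound := fun Z => Real.exp (q Z + (‖γ‖ + 1)))
    (ball_mem_nhds γ one_pos)
    (Filter.Eventually.of_forall fun x => (hF x).aestronglyMeasurable)
    (integrable_sphere (hF γ) _)
    (Continuous.aestronglyMeasurable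
      ((InnerProductSpace.toDual ℝ (Vec d)).continuous.comp
        ((hF γ).smul continuous_subtype_val)))
    (Filter.Eventually.of_forall fun Z x hx => ?_)
    (integrable_sphere (by fun_prop) _)
    (Filter.Eventually.of_forall fun Z x _ => ?_)
  · have := (InnerProductSpace.toDual ℝ (Vec d)).toContinuousLinearEquiv.integral_comp_comm
      (μ := surface d) (fun Z : sphere (0 : Vec d) 1 =>
        Real.exp (q Z + inner ℝ γ (Z : Vec d)) • (Z : Vec d))
    have e : InnerProductSpace.toDual ℝ (Vec d) (∫ Z : sphere (0 : Vec d) 1,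
        Real.exp (q Z + inner ℝ γ (Z : Vec d)) • (Z : Vec d) ∂(surface d)) =
        ∫ Z : sphere (0 : Vec d) 1, InnerProductSpace.toDual ℝ (Vec d)
          (Real.exp (q Z + inner ℝ γ (Z : Vec d)) • (Z : Vec d)) ∂(surface d) := this.symm
    rw [e]
    exact key
  · have hZ : ‖(Z : Vec d)‖ = 1 := by simp
    rw [LinearIsometryEquiv.norm_map, norm_smul, hZ, mul_one, Real.norm_eq_abs,
      abs_of_pos (Real.exp_pos _)]
    refine Real.exp_le_exp.2 (add_le_add_right ?_ _)
    have h1 := real_inner_le_norm x (Z : Vec d)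
    rw [hZ, mul_one] at h1
    rw [mem_ball, dist_eq_norm] at hx
    have := norm_le_norm_add_norm_sub' x γ
    linarith
  · have h1 : HasFDerivAt (fun y : Vec d => q Z + inner ℝ y (Z : Vec d))
        (innerSL ℝ (Z : Vec d)) x := by
      have := (innerSL ℝ (Z : Vec d)).hasFDerivAt (x := x)
      have h2 : (fun y : Vec d => q Z + inner ℝ y (Z : Vec d)) =
          fun y => q Z + innerSL ℝ (Z : Vec d) y := by
        funext y; rw [innerSL_apply_apply, real_inner_comm]
      rw [h2]
      exact this.const_add _
    refine h1.exp.congr_fderiv ?_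
    ext y
    simp

/-- The posterior mean for the prior `Q`. -/
def posteriorMean (Q : Measure (Vec d)) (D : Data d n) : Vec d :=
  (∫ θ, Real.exp (logLik D θ) ∂Q)⁻¹ • ∫ θ, Real.exp (logLik D θ) • θ ∂Q

lemma continuous_exp_logLik (D : Data d n) : Continuous fun θ : Vec d => Real.exp (logLik D θ) :=
  Real.continuous_exp.comp (continuous_logLik.comp (Continuous.prodMk_right D))

/-- The weights `1/N` and the total mass of the sphere cancel between numerator and denominator. -/
lemma fbEstimator_eq_posteriorMean [NeZero d] {N : ℕ} (hN : N ≠ 0) (b : Fin N → ℝ)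
    (D : Data d n) :
    fbEstimator b D = posteriorMean (radialExtension d (empMeasure b)) D := by
  have hc := continuous_exp_logLik D
  have hc' : Continuous fun θ : Vec d => Real.exp (logLik D θ) • θ := by fun_prop
  set S := (surface d Set.univ)⁻¹.toReal with hS
  have hS0 : S ≠ 0 := by
    rw [hS, ENNReal.toReal_inv]
    exact inv_ne_zero (ENNReal.toReal_ne_zero.2 ⟨surface_univ_ne_zero, measure_ne_top _ _⟩)
  have hN0 : (N : ℝ)⁻¹ ≠ 0 := inv_ne_zero (Nat.cast_ne_zero.2 hN)
  unfold posteriorMean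
  rw [integral_radialExtension_empMeasure b hc,
    integral_radialExtension_empMeasure b hc']
  simp_rw [uniformSphere, integral_smul_measure, ← hS]
  have key : ∀ (x : ℝ) (v : Vec d),
      ((N : ℝ)⁻¹ • S • x)⁻¹ • (N : ℝ)⁻¹ • S • v = x⁻¹ • v := fun x v => by
    rw [smul_smul, smul_smul, smul_eq_mul, smul_eq_mul]
    congr 1
    field_simp
  rw [← Finset.smul_sum, ← Finset.smul_sum, key]
  unfold fbEstimator
  congr 1
  · congr 1
    refine Finset.sum_congr rfl fun i _ => ?_
    simp only [fbConst, fb_exponent_eq_logLik]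
  · refine Finset.sum_congr rfl fun i _ => ?_
    rw [(hasGradientAt_fbConst _ _).gradient, ← integral_smul]
    refine integral_congr_ae (Filter.Eventually.of_forall fun Z => ?_)
    simp only [fb_exponent_eq_logLik]
    rw [smul_comm]

lemma integrable_of_continuous_of_ae_mem {E : Type*} [NormedAddCommGroup E] {Q : Measure (Vec d)}
    [IsFiniteMeasure Q] {B : ℝ} (hQ : ∀ᵐ θ ∂Q, θ ∈ closedBall (0 : Vec d) B) {g : Vec d → E}
    (hg : Continuous g) : Integrable g Q := by
  rw [← Measure.restrict_eq_self_of_ae_mem hQ]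
  exact hg.continuousOn.integrableOn_compact (isCompact_closedBall _ _)

lemma isEstimator_posteriorMean {Q : Measure (Vec d)} [IsProbabilityMeasure Q] {B : ℝ}
    (hQ : ∀ᵐ θ ∂Q, θ ∈ closedBall (0 : Vec d) B) :
    IsEstimator B (posteriorMean Q : Data d n → Vec d) := by
  have hm : Continuous fun p : Data d n × Vec d => Real.exp (logLik p.1 p.2) :=
    Real.continuous_exp.comp continuous_logLik
  refine ⟨?_, fun D => ?_⟩
  · have h1 : StronglyMeasurable fun D : Data d n => ∫ θ, Real.exp (logLik D θ) ∂Q :=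
      StronglyMeasurable.integral_prod_right hm.stronglyMeasurable
    have h2 : StronglyMeasurable fun D : Data d n => ∫ θ, Real.exp (logLik D θ) • θ ∂Q :=
      StronglyMeasurable.integral_prod_right (hm.smul continuous_snd).stronglyMeasurable
    exact h1.measurable.inv.smul h2.measurable
  · have hc := continuous_exp_logLik D
    have hi := integrable_of_continuous_of_ae_mem hQ hc
    have hpos := integral_exp_pos hi
    rw [mem_closedBall_zero_iff, posteriorMean, norm_smul, norm_inv, Real.norm_eq_abs,
      abs_of_pos hpos, inv_mul_le_iff₀ hpos, ← integral_mul_const]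
    refine (norm_integral_le_integral_norm _).trans ?_
    refine integral_mono_ae (integrable_of_continuous_of_ae_mem hQ (by fun_prop))
      (hi.mul_const _) ?_
    filter_upwards [hQ] with θ hθ
    rw [norm_smul, Real.norm_eq_abs, abs_of_pos (Real.exp_pos _)]
    exact mul_le_mul_of_nonneg_left (mem_closedBall_zero_iff.1 hθ) (Real.exp_pos _).le

lemma posteriorMean_rotateData {Q : Measure (Vec d)} (U : Vec d ≃ₗᵢ[ℝ] Vec d)
    (hQ : Q.map U = Q) (D : Data d n) :
    posteriorMean Q (rotateData U D) = U (posteriorMean Q D) := by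
  have hU := U.continuous.measurable.aemeasurable (μ := Q)
  have hc := continuous_exp_logLik (rotateData U D)
  have hc' : Continuous fun θ : Vec d => Real.exp (logLik (rotateData U D) θ) • θ := by fun_prop
  unfold posteriorMean
  have h1 : ∫ θ, Real.exp (logLik (rotateData U D) θ) ∂Q = ∫ θ, Real.exp (logLik D θ) ∂Q := by
    conv_lhs => rw [← hQ]
    rw [integral_map hU hc.aestronglyMeasurable]
    simp_rw [logLik_rotateData]
  have h2 : ∫ θ, Real.exp (logLik (rotateData U D) θ) • θ ∂Q =
      U (∫ θ, Real.exp (logLik D θ) • θ ∂Q) := by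
    conv_lhs => rw [← hQ]
    rw [integral_map hU hc'.aestronglyMeasurable]
    simp_rw [logLik_rotateData, ← map_smul]
    exact U.toContinuousLinearEquiv.integral_comp_comm _
  rw [h1, h2, map_smul]

/-- A rotation-invariant prior has an equivariant posterior mean, and isometries are transitive on
each sphere. This reduces nature's choice to a radius. -/
lemma risk_posteriorMean_eq_of_norm_eq [NeZero d] {B : ℝ} (Q : Measure ℝ)
    [IsProbabilityMeasure Q] (hQ : ∀ᵐ θ ∂(radialExtension d Q), θ ∈ closedBall (0 : Vec d) B)
    {θ θ' : Vec d} (h : ‖θ‖ = ‖θ'‖) :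
    risk (posteriorMean (radialExtension d Q) : Data d n → Vec d) θ =
      risk (posteriorMean (radialExtension d Q) : Data d n → Vec d) θ' := by
  obtain ⟨U, rfl⟩ := exists_linearIsometryEquiv_apply_eq h
  exact (risk_map_of_equivariant (isEstimator_posteriorMean hQ).1 U
    (fun D => posteriorMean_rotateData U (radialExtension_map Q U) D) θ).symm

/-- The weighted mean minimizes the weighted squared distance. -/
lemma integral_mul_norm_sub_sq_mean_le {Q : Measure (Vec d)} [IsProbabilityMeasure Q] {B : ℝ}
    (hQ : ∀ᵐ θ ∂Q, θ ∈ closedBall (0 : Vec d) B) (D : Data d n) (a : Vec d) :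
    ∫ θ, Real.exp (logLik D θ) * ‖posteriorMean Q D - θ‖ ^ 2 ∂Q ≤
      ∫ θ, Real.exp (logLik D θ) * ‖a - θ‖ ^ 2 ∂Q := by
  have hc := continuous_exp_logLik D
  have hi := integrable_of_continuous_of_ae_mem hQ hc
  have hpos := integral_exp_pos hi
  set m := posteriorMean Q D with hm
  have i2 : Integrable (fun θ => Real.exp (logLik D θ) • (m - θ)) Q :=
    integrable_of_continuous_of_ae_mem hQ (by fun_prop)
  have h0 : ∫ θ, Real.exp (logLik D θ) • (m - θ) ∂Q = 0 := by
    simp_rw [smul_sub]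
    rw [integral_sub (integrable_of_continuous_of_ae_mem hQ (by fun_prop))
      (integrable_of_continuous_of_ae_mem hQ (by fun_prop)), integral_smul_const, hm,
      posteriorMean, smul_smul, mul_inv_cancel₀ hpos.ne', one_smul, sub_self]
  have h1 : ∫ θ, inner ℝ (a - m) (Real.exp (logLik D θ) • (m - θ)) ∂Q = 0 := by
    rw [integral_inner i2, h0, inner_zero_right]
  -- The added cross term has integral zero; with it, the integrands differ by `exp (logLik D θ) ‖a
  -- - m‖² ≥ 0`.
  calc ∫ θ, Real.exp (logLik D θ) * ‖m - θ‖ ^ 2 ∂Q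
      = ∫ θ, (Real.exp (logLik D θ) * ‖m - θ‖ ^ 2 +
          2 * inner ℝ (a - m) (Real.exp (logLik D θ) • (m - θ))) ∂Q := by
        rw [integral_add (integrable_of_continuous_of_ae_mem hQ (by fun_prop))
          (integrable_of_continuous_of_ae_mem hQ (by fun_prop)), integral_const_mul, h1]
        simp
    _ ≤ _ := by
        refine integral_mono (integrable_of_continuous_of_ae_mem hQ (by fun_prop))
          (integrable_of_continuous_of_ae_mem hQ (by fun_prop)) fun θ => ?_
        have h2 : ‖a - θ‖ ^ 2 = ‖a - m‖ ^ 2 + 2 * inner ℝ (a - m) (m - θ) + ‖m - θ‖ ^ 2 := by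
          rw [← norm_add_sq_real, sub_add_sub_cancel]
        simp only
        rw [h2, inner_smul_right]
        nlinarith [mul_nonneg (Real.exp_pos (logLik D θ)).le (sq_nonneg ‖a - m‖)]

/-- Fubini with the dominating law `dataLaw n 0`: minimizing the integrated risk becomes a separate
minimization for each data set. -/
lemma IsEstimator.integral_risk {B : ℝ} {f : Data d n → Vec d} (hf : IsEstimator B f)
    {Q : Measure (Vec d)} [IsProbabilityMeasure Q] (hQ : ∀ᵐ θ ∂Q, θ ∈ closedBall (0 : Vec d) B) :
    Integrable (fun D => ∫ θ, Real.exp (logLik D θ) * ‖f D - θ‖ ^ 2 ∂Q) (dataLaw n (0 : Vec d)) ∧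
    ∫ θ, risk f θ ∂Q =
      ∫ D, ∫ θ, Real.exp (logLik D θ) * ‖f D - θ‖ ^ 2 ∂Q ∂(dataLaw n (0 : Vec d)) := by
  have hfm := hf.1
  have hl : Measurable fun p : Vec d × Data d n => Real.exp (logLik p.2 p.1) :=
    (Real.continuous_exp.comp (continuous_logLik.comp (by fun_prop :
      Continuous fun p : Vec d × Data d n => (p.2, p.1)))).measurable
  have hi : Integrable (fun p : Vec d × Data d n => Real.exp (logLik p.2 p.1) *
      ‖f p.2 - p.1‖ ^ 2) (Q.prod (dataLaw n (0 : Vec d))) := by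
    rw [integrable_prod_iff (Measurable.aestronglyMeasurable (by fun_prop))]
    constructor
    · filter_upwards [hQ] with θ hθ
      exact (integrable_dataLaw_iff _ _).1 (hf.integrable_loss hθ (dataLaw n θ))
    · refine (integrable_of_continuous_of_ae_mem hQ hf.continuous_risk).congr
        (Filter.Eventually.of_forall fun θ => ?_)
      simp only [norm_mul, norm_pow, Real.norm_eq_abs, abs_of_pos (Real.exp_pos _), abs_norm]
      exact integral_dataLaw (fun D => ‖f D - θ‖ ^ 2) θ
  refine ⟨hi.integral_prod_right, ?_⟩
  rw [← integral_integral_swap hi]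
  exact integral_congr_ae (Filter.Eventually.of_forall fun θ => integral_dataLaw (fun D => ‖f D - θ‖ ^ 2) θ)

/-- The posterior mean is a Bayes estimator. -/
lemma integral_risk_posteriorMean_le {B : ℝ} {Q : Measure (Vec d)}
    [IsProbabilityMeasure Q] (hQ : ∀ᵐ θ ∂Q, θ ∈ closedBall (0 : Vec d) B)
    {f : Data d n → Vec d} (hf : IsEstimator B f) :
    ∫ θ, risk (posteriorMean Q : Data d n → Vec d) θ ∂Q ≤ ∫ θ, risk f θ ∂Q := by
  obtain ⟨i1, e1⟩ := (isEstimator_posteriorMean (n := n) hQ).integral_risk hQ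
  obtain ⟨i2, e2⟩ := hf.integral_risk hQ
  rw [e1, e2]
  exact integral_mono i1 i2 fun D => integral_mul_norm_sub_sq_mean_le hQ D (f D)

variable {B : ℝ}

/-! Weak duality -/

lemma measurable_risk_estimator {θ : Vec d} (hθ : θ ∈ closedBall (0 : Vec d) B) :
    Measurable fun f : Estimator d n B => risk f.toFun θ := by
  have h : MeasurableSpace.comap (fun f : Estimator d n B => risk f.toFun θ) inferInstance ≤
      (inferInstance : MeasurableSpace (Estimator d n B)) :=
    le_iSup (fun θ : closedBall (0 : Vec d) B =>
      MeasurableSpace.comap (fun f : Estimator d n B => risk f.toFun (θ : Vec d)) inferInstance)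
      ⟨θ, hθ⟩
  exact (comap_measurable _).mono h le_rfl

lemma integral_risk_estimator_le (ν : ProbabilityMeasure (Estimator d n B))
    {θ : Vec d} (hθ : θ ∈ closedBall (0 : Vec d) B) :
    ∫ f : Estimator d n B, risk f.toFun θ ∂(ν : Measure (Estimator d n B)) ≤ 4 * B ^ 2 := by
  have h := norm_integral_le_of_norm_le_const (μ := (ν : Measure (Estimator d n B)))
    (f := fun f : Estimator d n B => risk f.toFun θ) (C := 4 * B ^ 2)
    (Filter.Eventually.of_forall fun f => by
      rw [Real.norm_eq_abs, abs_of_nonneg (risk_nonneg _ _)]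
      exact f.isEstimator.risk_le hθ)
  rw [probReal_univ, mul_one] at h
  exact (le_abs_self _).trans h

lemma bddAbove_integral_risk_estimator (ν : ProbabilityMeasure (Estimator d n B)) :
    BddAbove (Set.range fun θ : closedBall (0 : Vec d) B =>
      ∫ f : Estimator d n B, risk f.toFun (θ : Vec d) ∂(ν : Measure (Estimator d n B))) :=
  ⟨4 * B ^ 2, by rintro _ ⟨θ, rfl⟩; exact integral_risk_estimator_le ν θ.2⟩

/-- Every deterministic estimator is at most as good as the minimax risk in the worst case. -/
lemma minimaxRisk_le_worstRisk {f : Data d n → Vec d} (hf : IsEstimator B f) :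
    minimaxRisk d n B ≤ worstRisk B f := by
  let e : Estimator d n B := ⟨f, hf⟩
  refine (ciInf_le ⟨0, ?_⟩ (⟨Measure.dirac e, inferInstance⟩ :
    ProbabilityMeasure (Estimator d n B))).trans (le_of_eq ?_)
  · rintro _ ⟨ν, rfl⟩
    exact Real.iSup_nonneg fun θ => integral_nonneg fun f => risk_nonneg _ _
  · unfold worstRisk
    congr 1
    funext θ
    exact integral_dirac' _ e (measurable_risk_estimator θ.2).stronglyMeasurable

/-- The retraction of the space of regression vectors to the ball. -/
def clip (B : ℝ) (θ : Vec d) : Vec d := (B / max B ‖θ‖) • θ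

lemma continuous_clip (hB : 0 < B) : Continuous (clip B : Vec d → Vec d) := by
  unfold clip
  refine Continuous.smul (Continuous.div continuous_const
    (continuous_const.max continuous_norm) fun θ => ?_) continuous_id
  exact (lt_of_lt_of_le hB (le_max_left _ _)).ne'

lemma clip_mem (hB : 0 < B) (θ : Vec d) : clip B θ ∈ closedBall (0 : Vec d) B := by
  have h : 0 < max B ‖θ‖ := lt_of_lt_of_le hB (le_max_left _ _)
  rw [mem_closedBall_zero_iff, clip, norm_smul, Real.norm_eq_abs, abs_of_pos (by positivity),
    div_mul_eq_mul_div, div_le_iff₀ h]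
  exact mul_le_mul_of_nonneg_left (le_max_right _ _) hB.le

lemma clip_of_mem (hB : 0 < B) {θ : Vec d} (hθ : θ ∈ closedBall (0 : Vec d) B) :
    clip B θ = θ := by
  rw [mem_closedBall_zero_iff] at hθ
  rw [clip, max_eq_left hθ, div_self hB.ne', one_smul]

lemma bayesRisk_le {Q : Measure (Vec d)} {f : Data d n → Vec d} (hf : IsEstimator B f) :
    bayesRisk n B Q ≤ ∫ θ, risk f θ ∂Q :=
  ciInf_le (f := fun f : Estimator d n B => ∫ θ, risk f.toFun θ ∂Q)
    ⟨0, by rintro _ ⟨f, rfl⟩; exact integral_nonneg fun θ => risk_nonneg _ _⟩ ⟨f, hf⟩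

lemma nonempty_estimator (hB : 0 ≤ B) : Nonempty (Estimator d n B) :=
  ⟨⟨fun _ => 0, measurable_const, fun _ => mem_closedBall_self hB⟩⟩

/-- Weak duality: averaging a randomized estimator's risk over the prior gives at most its
worst-case risk, and by Fubini at least the Bayes risk. -/
lemma bayesRisk_le_minimaxRisk (hB : 0 < B) {Q : Measure (Vec d)} [IsProbabilityMeasure Q]
    (hQ : ∀ᵐ θ ∂Q, θ ∈ closedBall (0 : Vec d) B) :
    bayesRisk n B Q ≤ minimaxRisk d n B := by
  have hne := nonempty_estimator (d := d) (n := n) hB.le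
  have : Nonempty (ProbabilityMeasure (Estimator d n B)) :=
    ⟨⟨Measure.dirac hne.some, inferInstance⟩⟩
  refine le_ciInf fun ν => ?_
  -- The `σ`-algebra on estimators only makes risks at points of the ball measurable; clipping
  -- extends them to a jointly measurable function that agrees with the risk `Q`-almost everywhere.
  set u : Vec d → Estimator d n B → ℝ := fun θ f => risk f.toFun (clip B θ) with hu
  have hum : Measurable (Function.uncurry u) :=
    measurable_uncurry_of_continuous_of_measurable
      (fun f => f.isEstimator.continuous_risk.comp (continuous_clip hB))
      fun θ => measurable_risk_estimator (clip_mem hB θ)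
  have hi : Integrable (Function.uncurry u) (Q.prod (ν : Measure (Estimator d n B))) :=
    Integrable.of_bound (C := 4 * B ^ 2) hum.aestronglyMeasurable
      (Filter.Eventually.of_forall fun p => by
        simp only [Function.uncurry, hu]
        rw [Real.norm_eq_abs, abs_of_nonneg (risk_nonneg _ _)]
        exact p.2.isEstimator.risk_le (clip_mem hB p.1))
  have h1 : ∀ f : Estimator d n B, bayesRisk n B Q ≤ ∫ θ, u θ f ∂Q := fun f => by
    refine (bayesRisk_le f.isEstimator).trans_eq (integral_congr_ae ?_)
    filter_upwards [hQ] with θ hθ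
    rw [hu]
    simp only [clip_of_mem hB hθ]
  have h2 : bayesRisk n B Q ≤ ∫ f, ∫ θ, u θ f ∂Q ∂(ν : Measure (Estimator d n B)) := by
    have := integral_mono (μ := (ν : Measure (Estimator d n B)))
      (integrable_const (bayesRisk n B Q)) hi.integral_prod_right h1
    simpa using this
  refine h2.trans ?_
  rw [← integral_integral_swap hi]
  have h3 := integral_mono (μ := Q) hi.integral_prod_left
    (integrable_const (⨆ θ : closedBall (0 : Vec d) B,
      ∫ f : Estimator d n B, risk f.toFun (θ : Vec d) ∂(ν : Measure (Estimator d n B))))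
    fun θ => le_ciSup (bddAbove_integral_risk_estimator ν) ⟨clip B θ, clip_mem hB θ⟩
  simpa using h3

lemma bayesRisk_eq_integral_risk_posteriorMean (hB : 0 ≤ B) {Q : Measure (Vec d)}
    [IsProbabilityMeasure Q] (hQ : ∀ᵐ θ ∂Q, θ ∈ closedBall (0 : Vec d) B) :
    bayesRisk n B Q = ∫ θ, risk (posteriorMean Q : Data d n → Vec d) θ ∂Q := by
  have := nonempty_estimator (d := d) (n := n) hB
  exact le_antisymm (bayesRisk_le (isEstimator_posteriorMean hQ))
    (le_ciInf fun f => integral_risk_posteriorMean_le hQ f.isEstimator)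

/-! The exponential distribution -/

lemma expMeasure_eq_withDensity (η : ℝ) :
    expMeasure η = volume.withDensity (exponentialPDF η) := rfl

lemma measurable_exponentialPDF (η : ℝ) : Measurable (exponentialPDF η) :=
  (measurable_exponentialPDFReal η).ennreal_ofReal

lemma ae_nonneg_expMeasure (η : ℝ) : ∀ᵐ σ ∂(expMeasure η), 0 ≤ σ := by
  rw [expMeasure_eq_withDensity, ae_withDensity_iff (measurable_exponentialPDF η)]
  refine Filter.Eventually.of_forall fun σ h => ?_
  by_contra hσ
  exact h (exponentialPDF_of_neg (not_le.1 hσ))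

lemma integrable_id_expMeasure {η : ℝ} (hη : 0 < η) :
    Integrable (fun σ => σ) (expMeasure η) ∧ ∫ σ, σ ∂(expMeasure η) = 1 / η := by
  have h : ∫⁻ σ, ENNReal.ofReal σ ∂(expMeasure η) = ENNReal.ofReal (1 / η) := by
    rw [expMeasure_eq_withDensity, lintegral_withDensity_eq_lintegral_mul _
      (measurable_exponentialPDF η) (by fun_prop)]
    -- `σ` times the exponential density is `1/η` times the Gamma density of shape `2`.
    calc ∫⁻ σ, exponentialPDF η σ * ENNReal.ofReal σ
        = ∫⁻ σ, ENNReal.ofReal (1 / η) * gammaPDF 2 η σ := by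
          refine lintegral_congr fun σ => ?_
          rcases lt_or_ge σ 0 with hσ | hσ
          · rw [exponentialPDF_of_neg hσ, gammaPDF_of_neg hσ, zero_mul, mul_zero]
          · rw [exponentialPDF_of_nonneg hσ, gammaPDF_of_nonneg hσ,
              ← ENNReal.ofReal_mul (by positivity), ← ENNReal.ofReal_mul (by positivity)]
            congr 1
            have h2 : (2 : ℝ) - 1 = 1 := by norm_num
            rw [Real.Gamma_two, h2, Real.rpow_one, Real.rpow_two]
            field_simp
      _ = ENNReal.ofReal (1 / η) := by
          have hm : Measurable (gammaPDF 2 η) := (measurable_gammaPDFReal 2 η).ennreal_ofReal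
          rw [lintegral_const_mul _ hm, lintegral_gammaPDF_eq_one two_pos hη, mul_one]
  have hi : Integrable (fun σ => σ) (expMeasure η) := by
    refine ⟨by fun_prop, ?_⟩
    rw [hasFiniteIntegral_iff_ofReal (ae_nonneg_expMeasure η), h]
    exact ENNReal.ofReal_lt_top
  refine ⟨hi, ?_⟩
  rw [integral_eq_lintegral_of_nonneg_ae (ae_nonneg_expMeasure η) (by fun_prop), h,
    ENNReal.toReal_ofReal (by positivity)]

/-- The translated density satisfies `p (σ - s) ≤ exp (η s) p σ`, with equality for `σ ≥ s`. -/
lemma lintegral_shift_expMeasure_le {η s : ℝ} (hs : 0 ≤ s) {g : ℝ → ENNReal}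
    (hg : Measurable g) :
    ∫⁻ σ, g (σ + s) ∂(expMeasure η) ≤
      ENNReal.ofReal (Real.exp (η * s)) * ∫⁻ σ, g σ ∂(expMeasure η) := by
  have hp := measurable_exponentialPDF η
  rw [expMeasure_eq_withDensity, lintegral_withDensity_eq_lintegral_mul _ hp (by fun_prop),
    lintegral_withDensity_eq_lintegral_mul _ hp hg, ← lintegral_const_mul _ (by fun_prop)]
  calc ∫⁻ σ, exponentialPDF η σ * g (σ + s)
      = ∫⁻ σ, exponentialPDF η (σ + s - s) * g (σ + s) := by simp
    _ = ∫⁻ σ, exponentialPDF η (σ - s) * g σ :=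
        lintegral_add_right_eq_self (fun σ => exponentialPDF η (σ - s) * g σ) s
    _ ≤ _ := by
        refine lintegral_mono fun σ => ?_
        simp only [Pi.mul_apply]
        rw [← mul_assoc]
        refine mul_le_mul_left ?_ _
        rcases lt_or_ge (σ - s) 0 with h | h
        · rw [exponentialPDF_of_neg h]; exact zero_le
        · rw [exponentialPDF_of_nonneg h, exponentialPDF_of_nonneg (by linarith),
            ← ENNReal.ofReal_mul (Real.exp_pos _).le]
          refine ENNReal.ofReal_le_ofReal (le_of_eq ?_)
          rw [mul_left_comm, ← Real.exp_add]
          congr 2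
          ring

lemma integral_shift_sub_expMeasure_le {η s B : ℝ} (hη : 0 < η) (hs : 0 ≤ s) {g : ℝ → ℝ}
    (hg : Measurable g) (h0 : ∀ σ, 0 ≤ g σ) (hB : ∀ σ, g σ ≤ B) :
    ∫ σ, (g (σ + s) - g σ) ∂(expMeasure η) ≤ (Real.exp (η * s) - 1) * B := by
  have := isProbabilityMeasure_expMeasure hη
  have hb : ∀ g' : ℝ → ℝ, Measurable g' → (∀ σ, 0 ≤ g' σ) → (∀ σ, g' σ ≤ B) →
      Integrable g' (expMeasure η) := fun g' hm h0 hB =>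
    Integrable.of_bound (C := B) hm.aestronglyMeasurable (Filter.Eventually.of_forall fun σ => by
      rw [Real.norm_eq_abs, abs_of_nonneg (h0 σ)]; exact hB σ)
  have i1 := hb g hg h0 hB
  have i2 := hb (fun σ => g (σ + s)) (by fun_prop) (fun _ => h0 _) fun _ => hB _
  rw [integral_sub i2 i1]
  have h := lintegral_shift_expMeasure_le (η := η) hs hg.ennreal_ofReal
  rw [← ofReal_integral_eq_lintegral_ofReal i1 (Filter.Eventually.of_forall h0),
    ← ofReal_integral_eq_lintegral_ofReal i2 (Filter.Eventually.of_forall fun _ => h0 _),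
    ← ENNReal.ofReal_mul (Real.exp_pos _).le, ENNReal.ofReal_le_ofReal_iff
      (mul_nonneg (Real.exp_pos _).le (integral_nonneg h0))] at h
  have h2 : ∫ σ, g σ ∂(expMeasure η) ≤ B := by
    have := integral_mono i1 (integrable_const B) hB
    simpa using this
  have h3 : 0 ≤ Real.exp (η * s) - 1 := by
    rw [sub_nonneg, Real.one_le_exp_iff]; positivity
  nlinarith [mul_le_mul_of_nonneg_left h2 h3]

/-! Follow the perturbed leader on a grid -/

section Leader

variable {K : ℕ} {b : Fin K → ℝ}

/-- Add the two optimality inequalities. If `b x > b y`, the extra slope `2L` is only half consumed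
by the variation of `F`, which leaves `L (b x - b y) ≤ e`. -/
lemma argmax_sub_le {H F : Fin K → ℝ} {σ L e : ℝ} (hL : 0 < L) (he : 0 ≤ e)
    (hF : ∀ j j', F j - F j' ≤ L * |b j - b j'| + e) {x y : Fin K}
    (hx : ∀ j, H j + F j + σ * b j ≤ H x + F x + σ * b x)
    (hy : ∀ j, H j + (σ + 2 * L) * b j ≤ H y + (σ + 2 * L) * b y) : b x - b y ≤ e / L := by
  rw [le_div_iff₀ hL]
  rcases le_or_gt (b x) (b y) with h | h
  · nlinarith
  · have h1 := hx y
    have h2 := hy x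
    have h3 := hF x y
    rw [abs_of_pos (sub_pos.2 h)] at h3
    linarith

lemma argmax_mono {H : Fin K → ℝ} {σ σ' : ℝ} (hσ : σ < σ') {x y : Fin K}
    (hx : ∀ j, H j + σ * b j ≤ H x + σ * b x) (hy : ∀ j, H j + σ' * b j ≤ H y + σ' * b y) :
    b x ≤ b y := by
  have h1 := hx y
  have h2 := hy x
  by_contra! h
  nlinarith [mul_pos (sub_pos.2 hσ) (sub_pos.2 h)]

/-- Playing the leader that already knows the current round has no regret beyond the perturbation
term. -/
lemma be_the_leader {F : ℕ → Fin K → ℝ} {σ : ℝ} {x : ℕ → Fin K}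
    (hx : ∀ m j, ∑ i ∈ Finset.range m, F i j + σ * b j ≤
      ∑ i ∈ Finset.range m, F i (x m) + σ * b (x m)) (T : ℕ) (j : Fin K) :
    ∑ i ∈ Finset.range T, F i j + σ * b j ≤
      ∑ i ∈ Finset.range T, F i (x (i + 1)) + σ * b (x 0) := by
  induction T generalizing j with
  | zero => simpa using hx 0 j
  | succ T ih =>
    refine (hx (T + 1) j).trans ?_
    rw [Finset.sum_range_succ, Finset.sum_range_succ]
    linarith [ih (x (T + 1))]

/-- The regret beyond `σ B` is the price of using `x i` instead of `x (i + 1)`. Applying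
`argmax_sub_le` to adding `F i` and to removing it brackets both leaders at `σ` by those at `σ +
2L`; monotonicity makes the increments nonnegative. One `e i` comes from this comparison, the other
from `hF`. -/
lemma perturbed_leader_regret {F : ℕ → Fin K → ℝ} {e : ℕ → ℝ} {L B : ℝ} (hL : 0 < L)
    (he : ∀ i, 0 ≤ e i) (hF : ∀ i j j', F i j - F i j' ≤ L * |b j - b j'| + e i)
    (hb0 : ∀ j, 0 ≤ b j) (hbB : ∀ j, b j ≤ B) {x : ℕ → ℝ → Fin K}
    (hx : ∀ m σ j, ∑ i ∈ Finset.range m, F i j + σ * b j ≤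
      ∑ i ∈ Finset.range m, F i (x m σ) + σ * b (x m σ)) (T : ℕ) (j : Fin K) {σ : ℝ}
    (hσ : 0 ≤ σ) :
    ∑ i ∈ Finset.range T, F i j ≤ ∑ i ∈ Finset.range T, F i (x i σ) + σ * B +
      ∑ i ∈ Finset.range T, (L * ((b (x i (σ + 2 * L)) - b (x i σ)) +
        (b (x (i + 1) (σ + 2 * L)) - b (x (i + 1) σ))) + 2 * e i) := by
  have h1 := be_the_leader (fun m j => hx m σ j) T j
  have h2 : ∑ i ∈ Finset.range T, F i (x (i + 1) σ) ≤ ∑ i ∈ Finset.range T, F i (x i σ) +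
      ∑ i ∈ Finset.range T, (L * ((b (x i (σ + 2 * L)) - b (x i σ)) +
        (b (x (i + 1) (σ + 2 * L)) - b (x (i + 1) σ))) + 2 * e i) := by
    rw [← Finset.sum_add_distrib]
    refine Finset.sum_le_sum fun i _ => ?_
    have m1 : ∀ m, b (x m σ) ≤ b (x m (σ + 2 * L)) := fun m =>
      argmax_mono (by linarith) (hx m σ) (hx m (σ + 2 * L))
    have a1 : b (x (i + 1) σ) - b (x i (σ + 2 * L)) ≤ e i / L := by
      refine argmax_sub_le (H := fun j => ∑ i ∈ Finset.range i, F i j) (F := F i) (σ := σ) hL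
        (he i) (hF i) (fun j => ?_) (hx i (σ + 2 * L))
      have := hx (i + 1) σ j
      rwa [Finset.sum_range_succ, Finset.sum_range_succ] at this
    have a2 : b (x i σ) - b (x (i + 1) (σ + 2 * L)) ≤ e i / L := by
      refine argmax_sub_le (H := fun j => ∑ i ∈ Finset.range (i + 1), F i j)
        (F := fun j => - F i j) (σ := σ) hL (he i) (fun j j' => ?_) (fun j => ?_)
        (hx (i + 1) (σ + 2 * L))
      · have := hF i j' j
        rw [abs_sub_comm] at this
        linarith
      · have := hx i σ j
        simp only [Finset.sum_range_succ]
        linarith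
    have a3 : |b (x (i + 1) σ) - b (x i σ)| ≤ (b (x i (σ + 2 * L)) - b (x i σ)) +
        (b (x (i + 1) (σ + 2 * L)) - b (x (i + 1) σ)) + e i / L :=
      abs_le.2 ⟨by linarith [m1 i, m1 (i + 1)], by linarith [m1 i, m1 (i + 1)]⟩
    have a4 := hF i (x (i + 1) σ) (x i σ)
    have a5 := mul_le_mul_of_nonneg_left a3 hL.le
    have a6 : L * (e i / L) = e i := by field_simp
    rw [mul_add, a6] at a5
    linarith
  have h3 : σ * b (x 0 σ) ≤ σ * B := mul_le_mul_of_nonneg_left (hbB _) hσ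
  have h4 : 0 ≤ σ * b j := mul_nonneg hσ (hb0 j)
  linarith

/-- Regret of the perturbed leader that only sees noisy losses. -/
lemma integral_perturbed_leader_regret {Ω : Type*} [MeasurableSpace Ω] (μ : Measure Ω)
    [IsProbabilityMeasure μ] {η L B a V : ℝ} (hη : 0 < η) (hL : 0 < L) (ha : 0 < a)
    {sel : (Fin K → ℝ) → Fin K} (hsel : IsArgmaxRule sel)
    (hb0 : ∀ j, 0 ≤ b j) (hbB : ∀ j, b j ≤ B) {f : ℕ → Fin K → ℝ}
    (hf : ∀ i j j', f i j - f i j' ≤ L * |b j - b j'|) {F : ℕ → Ω → Fin K → ℝ}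
    (hFm : ∀ i, Measurable (F i))
    (hFi : ∀ i j, Integrable (fun ω => (F i ω j - f i j) ^ 2) μ)
    (hFV : ∀ i j, ∫ ω, (F i ω j - f i j) ^ 2 ∂μ ≤ V) (T : ℕ) (j : Fin K) :
    ∑ i ∈ Finset.range T, f i j ≤
      ∑ i ∈ Finset.range T, ∫ c : ℝ × Ω,
        f i (sel fun j => ∑ m ∈ Finset.range i, F m c.2 j + c.1 * b j)
          ∂((expMeasure η).prod μ) +
      (B / η + T * (2 * L * ((Real.exp (η * (2 * L)) - 1) * B) +
        6 * (a / 2 + K * V / (2 * a)))) := by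
  have := isProbabilityMeasure_expMeasure hη
  set x : ℕ → ℝ → Ω → Fin K := fun i σ ω =>
    sel fun j => ∑ m ∈ Finset.range i, F m ω j + σ * b j with hxdef
  -- By AM–GM, `Δ i` dominates the errors at all grid points at once, so second moments suffice and
  -- `a` is free to be tuned.
  set Δ : ℕ → Ω → ℝ := fun i ω => a / 2 + (∑ j, (F i ω j - f i j) ^ 2) / (2 * a) with hΔ
  have hΔ0 : ∀ i ω, 0 ≤ Δ i ω := fun i ω => by
    have : 0 ≤ ∑ j, (F i ω j - f i j) ^ 2 := Finset.sum_nonneg fun _ _ => sq_nonneg _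
    simp only [hΔ]; positivity
  have habs : ∀ i ω j, |F i ω j - f i j| ≤ Δ i ω := fun i ω j => by
    have h1 : (F i ω j - f i j) ^ 2 ≤ ∑ j, (F i ω j - f i j) ^ 2 :=
      Finset.single_le_sum (f := fun j => (F i ω j - f i j) ^ 2) (fun _ _ => sq_nonneg _)
        (Finset.mem_univ j)
    have h2 : |F i ω j - f i j| ≤ a / 2 + (F i ω j - f i j) ^ 2 / (2 * a) := by
      have h3 : a / 2 + (F i ω j - f i j) ^ 2 / (2 * a) - |F i ω j - f i j| =
          (|F i ω j - f i j| - a) ^ 2 / (2 * a) := by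
        rw [sub_sq |F i ω j - f i j| a, sq_abs]; field_simp; ring
      have h4 : 0 ≤ (|F i ω j - f i j| - a) ^ 2 / (2 * a) := by positivity
      linarith
    refine h2.trans ?_
    simp only [hΔ]
    gcongr
  have hmx : ∀ i, Measurable fun c : ℝ × Ω => x i c.1 c.2 := fun i => by
    refine hsel.1.comp (measurable_pi_lambda _ fun j => ?_)
    refine Measurable.add (Finset.measurable_sum _ fun m _ => ?_) (by fun_prop)
    exact (measurable_pi_apply j).comp ((hFm m).comp measurable_snd)
  have hmb : ∀ (i : ℕ) (s : ℝ), Measurable fun c : ℝ × Ω => b (x i (c.1 + s) c.2) := fun i s =>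
    (measurable_of_countable b).comp ((hmx i).comp
      (by fun_prop : Measurable fun c : ℝ × Ω => (c.1 + s, c.2)))
  have hib : ∀ (i : ℕ) (s : ℝ), Integrable (fun c : ℝ × Ω => b (x i (c.1 + s) c.2))
      ((expMeasure η).prod μ) := fun i s =>
    Integrable.of_bound (C := B) (hmb i s).aestronglyMeasurable
      (Filter.Eventually.of_forall fun c => by
        rw [Real.norm_eq_abs, abs_of_nonneg (hb0 _)]; exact hbB _)
  have hib0 : ∀ i : ℕ, Integrable (fun c : ℝ × Ω => b (x i c.1 c.2))
      ((expMeasure η).prod μ) := fun i => by simpa using hib i 0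
  have hif : ∀ i, Integrable (fun c : ℝ × Ω => f i (x i c.1 c.2)) ((expMeasure η).prod μ) :=
    fun i => Integrable.of_bound (C := ∑ j, |f i j|)
      ((measurable_of_countable (f i)).comp (hmx i)).aestronglyMeasurable
      (Filter.Eventually.of_forall fun c => by
        rw [Real.norm_eq_abs]
        exact Finset.single_le_sum (f := fun j => |f i j|) (fun _ _ => abs_nonneg _)
          (Finset.mem_univ _))
  have hiΔ : ∀ i, Integrable (Δ i) μ := fun i =>
    (integrable_const _).add ((integrable_finsetSum _ fun j _ => hFi i j).div_const _)
  have hΔV : ∀ i, ∫ ω, Δ i ω ∂μ ≤ a / 2 + K * V / (2 * a) := fun i => by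
    simp only [hΔ]
    rw [integral_add (integrable_const _)
      ((integrable_finsetSum _ fun j _ => hFi i j).div_const _), integral_div (2 * a),
      integral_finsetSum _ fun j _ => hFi i j]
    have : ∑ j, ∫ ω, (F i ω j - f i j) ^ 2 ∂μ ≤ K * V := by
      refine (Finset.sum_le_sum fun j _ => hFV i j).trans_eq ?_
      simp
    simp only [integral_const, probReal_univ, one_smul]
    gcongr
  have hishift : ∀ i, Integrable (fun c : ℝ × Ω => b (x i (c.1 + 2 * L) c.2) - b (x i c.1 c.2))
      ((expMeasure η).prod μ) := fun i => (hib i (2 * L)).sub (hib0 i)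
  have hshift : ∀ i, ∫ c : ℝ × Ω, (b (x i (c.1 + 2 * L) c.2) - b (x i c.1 c.2))
      ∂((expMeasure η).prod μ) ≤ (Real.exp (η * (2 * L)) - 1) * B := fun i => by
    rw [integral_prod_symm _ (hishift i)]
    have := integral_mono (μ := μ) (hishift i).integral_prod_right
      (integrable_const ((Real.exp (η * (2 * L)) - 1) * B)) fun ω =>
      integral_shift_sub_expMeasure_le (g := fun σ => b (x i σ ω)) hη (by positivity)
        ((measurable_of_countable b).comp ((hmx i).comp measurable_prodMk_right))
        (fun _ => hb0 _) fun _ => hbB _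
    simpa using this
  -- One draw `(σ, ω)` is shared by all rounds: only the marginal law of each leader matters for the
  -- sum of expectations. The `6` is `4` from `2 e i = 4 Δ i`, plus one `Δ i` for each replacement
  -- of `f` by `F` or back.
  have hpt : ∀ᵐ c ∂((expMeasure η).prod μ), ∑ i ∈ Finset.range T, f i j ≤
      ∑ i ∈ Finset.range T, f i (x i c.1 c.2) + c.1 * B +
      ∑ i ∈ Finset.range T, (L * ((b (x i (c.1 + 2 * L) c.2) - b (x i c.1 c.2)) +
        (b (x (i + 1) (c.1 + 2 * L) c.2) - b (x (i + 1) c.1 c.2))) + 6 * Δ i c.2) := by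
    have hσ : ∀ᵐ c ∂((expMeasure η).prod μ), 0 ≤ c.1 :=
      Measure.quasiMeasurePreserving_fst.ae (ae_nonneg_expMeasure η)
    filter_upwards [hσ] with c hc
    have key := perturbed_leader_regret (b := b) (F := fun i => F i c.2)
      (e := fun i => 2 * Δ i c.2) hL (fun i => mul_nonneg two_pos.le (hΔ0 i c.2))
      (fun i j j' => by
        have h1 := abs_le.1 (habs i c.2 j)
        have h2 := abs_le.1 (habs i c.2 j')
        linarith [hf i j j']) hb0 hbB (x := fun m σ => x m σ c.2)
      (fun m σ j => hsel.2 (fun j => ∑ i ∈ Finset.range m, F i c.2 j + σ * b j) j) T j hc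
    have h1 : ∑ i ∈ Finset.range T, f i j ≤ ∑ i ∈ Finset.range T, F i c.2 j +
        ∑ i ∈ Finset.range T, Δ i c.2 := by
      rw [← Finset.sum_add_distrib]
      exact Finset.sum_le_sum fun i _ => by linarith [(abs_le.1 (habs i c.2 j)).1]
    have h2 : ∑ i ∈ Finset.range T, F i c.2 (x i c.1 c.2) ≤
        ∑ i ∈ Finset.range T, f i (x i c.1 c.2) + ∑ i ∈ Finset.range T, Δ i c.2 := by
      rw [← Finset.sum_add_distrib]
      exact Finset.sum_le_sum fun i _ => by linarith [(abs_le.1 (habs i c.2 (x i c.1 c.2))).2]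
    rw [Finset.sum_add_distrib, ← Finset.mul_sum, ← Finset.mul_sum] at key ⊢
    rw [← Finset.mul_sum] at key
    linarith
  have hi2 : ∀ i, Integrable (fun c : ℝ × Ω =>
      L * ((b (x i (c.1 + 2 * L) c.2) - b (x i c.1 c.2)) +
        (b (x (i + 1) (c.1 + 2 * L) c.2) - b (x (i + 1) c.1 c.2))) + 6 * Δ i c.2)
      ((expMeasure η).prod μ) := fun i =>
    (((hishift i).add (hishift (i + 1))).const_mul L).add
      (((hiΔ i).comp_snd (expMeasure η)).const_mul 6)
  have hiσ : Integrable (fun c : ℝ × Ω => c.1 * B) ((expMeasure η).prod μ) :=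
    ((integrable_id_expMeasure hη).1.comp_fst μ).mul_const B
  have hif' : Integrable (fun c : ℝ × Ω => ∑ i ∈ Finset.range T, f i (x i c.1 c.2) + c.1 * B)
      ((expMeasure η).prod μ) :=
    (integrable_finsetSum (Finset.range T) fun i _ => hif i).add hiσ
  have hint := integral_mono_ae (integrable_const _)
    (hif'.add
      (integrable_finsetSum (Finset.range T) fun i _ => hi2 i)) hpt
  simp only [Pi.add_apply] at hint
  rw [integral_add hif'
    (integrable_finsetSum (Finset.range T) fun i _ => hi2 i),
    integral_add (integrable_finsetSum (Finset.range T) fun i _ => hif i) hiσ,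
    integral_finsetSum _ fun i _ => hif i, integral_finsetSum _ fun i _ => hi2 i] at hint
  have hσB : ∫ c : ℝ × Ω, c.1 * B ∂((expMeasure η).prod μ) = B / η := by
    rw [integral_mul_const, integral_fun_fst (fun σ : ℝ => σ), (integrable_id_expMeasure hη).2]
    simp; ring
  have hlast : ∑ i ∈ Finset.range T, ∫ c : ℝ × Ω,
      (L * ((b (x i (c.1 + 2 * L) c.2) - b (x i c.1 c.2)) +
        (b (x (i + 1) (c.1 + 2 * L) c.2) - b (x (i + 1) c.1 c.2))) + 6 * Δ i c.2)
      ∂((expMeasure η).prod μ) ≤ T * (2 * L * ((Real.exp (η * (2 * L)) - 1) * B) +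
        6 * (a / 2 + K * V / (2 * a))) := by
    refine (Finset.sum_le_card_nsmul _ _ (2 * L * ((Real.exp (η * (2 * L)) - 1) * B) +
        6 * (a / 2 + K * V / (2 * a))) fun i _ => ?_).trans_eq (by simp [mul_add])
    have hi3 : Integrable (fun c : ℝ × Ω => (b (x i (c.1 + 2 * L) c.2) - b (x i c.1 c.2)) +
        (b (x (i + 1) (c.1 + 2 * L) c.2) - b (x (i + 1) c.1 c.2))) ((expMeasure η).prod μ) :=
      (hishift i).add (hishift (i + 1))
    rw [integral_add (hi3.const_mul L)
      (((hiΔ i).comp_snd (expMeasure η)).const_mul 6), integral_const_mul, integral_const_mul,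
      integral_add (hishift i) (hishift (i + 1)), integral_fun_snd (Δ i)]
    have h1 := hshift i
    have h2 := hshift (i + 1)
    have h3 := hΔV i
    simp only [probReal_univ, one_smul]
    nlinarith [mul_le_mul_of_nonneg_left (add_le_add h1 h2) hL.le]
  simp only [integral_const, probReal_univ, one_smul] at hint
  rw [hσB] at hint
  linarith

end Leader

/-! Monte Carlo estimates -/

/-- Two-sided Hoeffding inequality for the empirical mean of a function with values in `[0, 1]`. -/
lemma pi_abs_mean_sub_ge_le {Ω : Type*} [MeasurableSpace Ω] (ρ : Measure Ω) [IsProbabilityMeasure ρ]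
    {X : Ω → ℝ} (hX : Measurable X) (h01 : ∀ ω, X ω ∈ Set.Icc (0 : ℝ) 1) {N : ℕ} (hN : N ≠ 0)
    {ε : ℝ} (hε : 0 ≤ ε) :
    (Measure.pi fun _ : Fin N => ρ).real {y | ε ≤ |(∑ k, X (y k)) / N - ∫ ω, X ω ∂ρ|} ≤
      2 * Real.exp (-2 * N * ε ^ 2) := by
  set μ := Measure.pi fun _ : Fin N => ρ
  have hN' : (0 : ℝ) < N := Nat.cast_pos.2 (Nat.pos_of_ne_zero hN)
  have hcomp : ∀ k : Fin N, Measurable fun y : Fin N → Ω => X (y k) := fun k =>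
    hX.comp (measurable_pi_apply k)
  have hmean : ∀ k : Fin N, ∫ y, X (y k) ∂μ = ∫ ω, X ω ∂ρ := fun k => by
    rw [← (measurePreserving_eval (fun _ : Fin N => ρ) k).map_eq,
      integral_map (measurable_pi_apply k).aemeasurable hX.aestronglyMeasurable]
  have hsub : ∀ k : Fin N, HasSubgaussianMGF (fun y : Fin N → Ω => X (y k) - ∫ ω, X ω ∂ρ)
      ((‖(1 : ℝ) - 0‖₊ / 2) ^ 2) μ := fun k => by
    have := hasSubgaussianMGF_of_mem_Icc (μ := μ) (hcomp k).aemeasurable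
      (Filter.Eventually.of_forall fun y => h01 (y k))
    rwa [hmean k] at this
  have hind : iIndepFun (fun (k : Fin N) (y : Fin N → Ω) => X (y k) - ∫ ω, X ω ∂ρ) μ :=
    iIndepFun_pi (X := fun _ ω => X ω - ∫ ω, X ω ∂ρ) fun _ => (hX.sub_const _).aemeasurable
  have hind' : iIndepFun (fun (k : Fin N) => -fun (y : Fin N → Ω) => X (y k) - ∫ ω, X ω ∂ρ) μ :=
    iIndepFun_pi (X := fun _ ω => -(X ω - ∫ ω, X ω ∂ρ)) fun _ => (hX.sub_const _).neg.aemeasurable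
  have h1 := HasSubgaussianMGF.measure_sum_ge_le_of_iIndepFun hind (s := Finset.univ)
    (fun k _ => hsub k) (ε := N * ε) (by positivity)
  have h2 := HasSubgaussianMGF.measure_sum_ge_le_of_iIndepFun hind' (s := Finset.univ)
    (fun k _ => (hsub k).neg) (ε := N * ε) (by positivity)
  -- A variable in `[0, 1]` has sub-Gaussian parameter `1/4`, so the exponent is `-(N ε)² / (2 ·
  -- N/4)`.
  have hexp : -(N * ε) ^ 2 / (2 * ∑ k : Fin N, (((‖(1 : ℝ) - 0‖₊ / 2) ^ 2 : NNReal) : ℝ)) =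
      -2 * N * ε ^ 2 := by
    simp only [sub_zero, nnnorm_one, Finset.sum_const, Finset.card_univ, Fintype.card_fin,
      nsmul_eq_mul]
    push_cast
    field_simp
  simp only [NNReal.coe_sum] at h1 h2
  rw [hexp] at h1 h2
  rw [two_mul]
  refine (measureReal_mono (s₂ := {y | N * ε ≤ ∑ k, (X (y k) - ∫ ω, X ω ∂ρ)} ∪
    {y | N * ε ≤ ∑ k, (-fun (y : Fin N → Ω) => X (y k) - ∫ ω, X ω ∂ρ) y}) (fun y hy => ?_)).trans
    ((measureReal_union_le _ _).trans (add_le_add h1 h2))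
  have hs : ∑ k, (X (y k) - ∫ ω, X ω ∂ρ) = N * ((∑ k, X (y k)) / N - ∫ ω, X ω ∂ρ) := by
    rw [Finset.sum_sub_distrib]
    simp
    field_simp
  simp only [Set.mem_union, Set.mem_ofPred_eq, Pi.neg_apply, Finset.sum_neg_distrib] at hy ⊢
  rw [hs]
  rcases le_abs.1 hy with h | h
  · exact Or.inl (mul_le_mul_of_nonneg_left h hN'.le)
  · exact Or.inr (by rw [← mul_neg]; exact mul_le_mul_of_nonneg_left h hN'.le)

/-- The mean squared error of the Monte Carlo estimate of a risk. -/
lemma integral_empRisk_sub_sq_le {ι : Type*} [Fintype ι] {N : ℕ} (hN : N ≠ 0) {B : ℝ}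
    {f : Data d n → Vec d} (hf : IsEstimator B f) {θ : Vec d}
    (hθ : θ ∈ closedBall (0 : Vec d) B) (β : ι → Vec d) {e : Fin N → ι}
    (he : Function.Injective e) (hβ : ∀ m, β (e m) = θ) :
    Integrable (fun ω : ι → Data d n => (empRisk f θ (fun m => ω (e m)) - risk f θ) ^ 2)
      (Measure.pi fun q => dataLaw n (β q)) ∧
    ∫ ω : ι → Data d n, (empRisk f θ (fun m => ω (e m)) - risk f θ) ^ 2
      ∂(Measure.pi fun q => dataLaw n (β q)) ≤ 4 * B ^ 4 / N := by
  set μ := Measure.pi fun q => dataLaw n (β q)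
  have hN' : (0 : ℝ) < N := Nat.cast_pos.2 (Nat.pos_of_ne_zero hN)
  have hl := hf.measurable_loss θ
  set Y : Fin N → (ι → Data d n) → ℝ := fun m ω => ‖f (ω (e m)) - θ‖ ^ 2 with hY
  have hYm : ∀ m, Measurable (Y m) := fun m => hl.comp (measurable_pi_apply (e m))
  have hYb : ∀ m ω, Y m ω ∈ Set.Icc 0 (4 * B ^ 2) := fun m ω =>
    ⟨sq_nonneg _, norm_sub_sq_le (hf.2 _) hθ⟩
  have hYL : ∀ m, MemLp (Y m) 2 μ := fun m =>
    MemLp.of_bound (hYm m).aestronglyMeasurable (4 * B ^ 2) (Filter.Eventually.of_forall fun ω => by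
      rw [Real.norm_eq_abs, abs_of_nonneg (hYb m ω).1]; exact (hYb m ω).2)
  have hYmean : ∀ m, ∫ ω, Y m ω ∂μ = risk f θ := fun m => by
    have hp := measurePreserving_eval (fun q => dataLaw n (β q)) (e m)
    rw [hβ] at hp
    unfold risk
    rw [← hp.map_eq, integral_map hp.measurable.aemeasurable hl.aestronglyMeasurable]
  have hvar : Var[∑ m, Y m; μ] ≤ N * (4 * B ^ 4) := by
    rw [IndepFun.variance_sum (fun m _ => hYL m)]
    · refine (Finset.sum_le_card_nsmul _ _ (4 * B ^ 4) fun m _ => ?_).trans_eq (by simp)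
      -- Popoviciu: values in an interval of length `4B²` give variance at most `(2B²)²`.
      refine (variance_le_sq_of_bounded (Filter.Eventually.of_forall (hYb m))
        (hYm m).aemeasurable).trans_eq ?_
      ring
    · intro m _ m' _ hm
      exact (iIndepFun_pi (X := fun (_ : ι) D => ‖f D - θ‖ ^ 2) (μ := fun q => dataLaw n (β q))
        fun _ => hl.aemeasurable).indepFun (he.ne hm)
  have hSL : MemLp (∑ m, Y m) 2 μ := memLp_finsetSum' _ fun m _ => hYL m
  have hmean : ∫ ω, (∑ m, Y m) ω ∂μ = N * risk f θ := by
    simp only [Finset.sum_apply]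
    rw [integral_finsetSum _ fun m _ => (hYL m).integrable (by norm_num)]
    simp [hYmean]
  have hrew : ∀ ω : ι → Data d n, (empRisk f θ (fun m => ω (e m)) - risk f θ) ^ 2 =
      ((∑ m, Y m) ω - N * risk f θ) ^ 2 / N ^ 2 := fun ω => by
    simp only [empRisk, Finset.sum_apply, hY]
    field_simp
  simp_rw [hrew]
  have hcent : MemLp (fun ω => (∑ m, Y m) ω - N * risk f θ) 2 μ := hSL.sub (memLp_const _)
  refine ⟨hcent.integrable_sq.div_const _, ?_⟩
  rw [variance_eq_integral hSL.aestronglyMeasurable.aemeasurable, hmean] at hvar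
  rw [integral_div, div_le_div_iff₀ (by positivity) hN']
  nlinarith

/-! ### Adaptedness and measurability of the run -/

variable {T K N₁ N₂ : ℕ} [NeZero d] {sel : (Fin K → ℝ) → Fin K}

lemma gridPoint_nonneg (hB : 0 ≤ B) (j : Fin K) : 0 ≤ gridPoint B K j := by
  unfold gridPoint; positivity

lemma gridPoint_le (hB : 0 ≤ B) (j : Fin K) : gridPoint B K j ≤ B := by
  have hK : (0 : ℝ) < K := Nat.cast_pos.2 (Fin.pos j)
  have hj : ((j : ℕ) : ℝ) + 1 ≤ K := by exact_mod_cast j.2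
  rw [gridPoint, div_le_iff₀ hK]
  exact mul_le_mul_of_nonneg_left hj hB

lemma norm_axisVec (b : ℝ) : ‖axisVec d b‖ = |b| := by
  simp [axisVec, norm_smul]

lemma axisVec_mem {b : ℝ} (hb : |b| ≤ B) : axisVec d b ∈ closedBall (0 : Vec d) B := by
  rwa [mem_closedBall_zero_iff, norm_axisVec]

lemma abs_gridPoint_le (hB : 0 ≤ B) (j : Fin K) : |gridPoint B K j| ≤ B := by
  rw [abs_of_nonneg (gridPoint_nonneg hB j)]; exact gridPoint_le hB j

lemma isEstimator_fbEstimator {N : ℕ} (hN : N ≠ 0) {b : Fin N → ℝ} (hb : ∀ k, |b k| ≤ B) :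
    IsEstimator B (fbEstimator b : Data d n → Vec d) := by
  have := isProbabilityMeasure_empMeasure hN b
  have h : (fbEstimator b : Data d n → Vec d) = posteriorMean (radialExtension d (empMeasure b)) :=
    funext fun D => fbEstimator_eq_posteriorMean hN b D
  rw [h]
  exact isEstimator_posteriorMean (ae_mem_radialExtension_empMeasure hb)

/-- The minimization oracle for radii on the grid. -/
def gridEstimator (d n : ℕ) (B : ℝ) (v : Fin N₂ → Fin K) : Data d n → Vec d :=
  fbEstimator fun k => gridPoint B K (v k)

lemma isEstimator_gridEstimator (hB : 0 ≤ B) (hN₂ : N₂ ≠ 0) (v : Fin N₂ → Fin K) :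
    IsEstimator B (gridEstimator d n B v) :=
  isEstimator_fbEstimator hN₂ fun _ => abs_gridPoint_le hB _

/-- The Monte Carlo estimate, from the data sets `ω`, of the risk at the grid position `j` of the
estimator of iteration `i`, which is given by the sampled grid positions `v`. -/
def estimatedRisk (B : ℝ) (v : Fin N₂ → Fin K) (i : Fin T) (j : Fin K)
    (ω : Fin T × Fin K × Fin N₁ → Data d n) : ℝ :=
  empRisk (gridEstimator d n B v) (axisVec d (gridPoint B K j)) fun m => ω (i, j, m)

/-- The output of one call of the maximization oracle in iteration `t`, as a function of the
grid positions `h` that were sampled in the earlier iterations. -/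
def callPick (B : ℝ) (sel : (Fin K → ℝ) → Fin K) (h : Fin T → Fin N₂ → Fin K) (t : Fin T)
    (c : CallSeed d n T K N₁) : Fin K :=
  sel fun j => (∑ i : {i : Fin T // i < t}, estimatedRisk B (h i.1) i.1 j c.2) +
    c.1 * gridPoint B K j

lemma picks_apply (s : Seeds d n T K N₁ N₂) (t : Fin T) (k : Fin N₂) :
    picks B sel s t k = callPick B sel (picks B sel s) t (s t k) := by
  rw [picks]; rfl

lemma callPick_congr {h h' : Fin T → Fin N₂ → Fin K} {t : Fin T} (hh : ∀ i < t, h i = h' i)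
    (c : CallSeed d n T K N₁) : callPick B sel h t c = callPick B sel h' t c := by
  have : ∀ j, ∑ i : {i : Fin T // i < t}, estimatedRisk B (h i.1) i.1 j c.2 =
      ∑ i : {i : Fin T // i < t}, estimatedRisk B (h' i.1) i.1 j c.2 := fun j =>
    Finset.sum_congr rfl fun i _ => by rw [hh i.1 i.2]
  simp only [callPick, this]

/-- Causality: resampling the inputs of round `t` leaves earlier rounds untouched, which permits
conditioning on the past. -/
lemma picks_congr {s s' : Seeds d n T K N₁ N₂} (t : Fin T) (h : ∀ i ≤ t, s i = s' i) :
    picks B sel s t = picks B sel s' t := by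
  induction t using WellFoundedLT.induction with
  | ind t ih =>
    funext k
    rw [picks_apply, picks_apply, h t le_rfl]
    exact callPick_congr (fun i hi => ih i hi fun i' hi' => h i' (hi'.trans hi.le)) _

lemma measurable_estimatedRisk (hB : 0 ≤ B) (hN₂ : N₂ ≠ 0) (v : Fin N₂ → Fin K) (i : Fin T)
    (j : Fin K) : Measurable (estimatedRisk (d := d) (n := n) (N₁ := N₁) B v i j) := by
  have hl := (isEstimator_gridEstimator (d := d) (n := n) hB hN₂ v).measurable_loss
    (axisVec d (gridPoint B K j))
  unfold estimatedRisk empRisk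
  exact (Finset.measurable_sum _ fun m _ => hl.comp (measurable_pi_apply (i, j, m))).div_const _

lemma measurable_callPick (hB : 0 ≤ B) (hN₂ : N₂ ≠ 0) (hsel : Measurable sel)
    (h : Fin T → Fin N₂ → Fin K) (t : Fin T) :
    Measurable (callPick (d := d) (n := n) (N₁ := N₁) B sel h t) := by
  refine hsel.comp (measurable_pi_lambda _ fun j => ?_)
  refine Measurable.add (Finset.measurable_sum _ fun i _ => ?_) (by fun_prop)
  exact (measurable_estimatedRisk hB hN₂ _ _ _).comp measurable_snd

lemma measurable_picks (hB : 0 ≤ B) (hN₂ : N₂ ≠ 0) (hsel : Measurable sel) (t : Fin T) :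
    Measurable fun s : Seeds d n T K N₁ N₂ => picks B sel s t := by
  induction t using WellFoundedLT.induction with
  | ind t ih =>
    refine measurable_pi_lambda _ fun k => ?_
    simp_rw [picks_apply]
    refine hsel.comp (measurable_pi_lambda _ fun j => ?_)
    refine Measurable.add (Finset.measurable_sum _ fun i _ => ?_) (by fun_prop)
    -- The earlier picks range over a finite type, so joint measurability can be checked one value
    -- at a time.
    have hG : Measurable fun p : (Fin N₂ → Fin K) × (Fin T × Fin K × Fin N₁ → Data d n) =>
        estimatedRisk B p.1 i.1 j p.2 :=
      measurable_from_prod_countable_right fun v => measurable_estimatedRisk hB hN₂ v _ _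
    have hs : Measurable fun s : Seeds d n T K N₁ N₂ => (picks B sel s i.1, (s t k).2) :=
      (ih i.1 i.2).prodMk
        (measurable_snd.comp ((measurable_pi_apply k).comp (measurable_pi_apply t)))
    have h3 := hG.comp hs
    simp only [Function.comp_def] at h3
    exact h3

/-! ### Concentration of the sampled radii -/

variable (d n N₁) in
/-- The probability that a call of the maximization oracle in iteration `t` returns the grid
position `j`. -/
def pickProb (B η : ℝ) (sel : (Fin K → ℝ) → Fin K) (h : Fin T → Fin N₂ → Fin K) (t : Fin T)
    (j : Fin K) : ℝ :=
  (callLaw d n T K N₁ B η).real {c | callPick B sel h t c = j}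

lemma isProbabilityMeasure_callLaw {η : ℝ} (hη : 0 < η) :
    IsProbabilityMeasure (callLaw d n T K N₁ B η) := by
  have := isProbabilityMeasure_expMeasure hη
  unfold callLaw; infer_instance

/-- The fraction of the samples that are equal to `j`. -/
def empFreq (v : Fin N₂ → Fin K) (j : Fin K) : ℝ := (∑ k, if v k = j then (1 : ℝ) else 0) / N₂

lemma measurableSet_empFreq_ge (hB : 0 ≤ B) (hN₂ : N₂ ≠ 0) (hsel : Measurable sel) (η ε : ℝ)
    (t : Fin T) (j : Fin K) :
    MeasurableSet {s : Seeds d n T K N₁ N₂ |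
      ε ≤ |empFreq (picks B sel s t) j - pickProb d n N₁ B η sel (picks B sel s) t j|} := by
  have h : Measurable fun s : Seeds d n T K N₁ N₂ => picks B sel s :=
    measurable_pi_lambda _ fun t => measurable_picks hB hN₂ hsel t
  exact h (Set.toFinite {p : Fin T → Fin N₂ → Fin K |
    ε ≤ |empFreq (p t) j - pickProb d n N₁ B η sel p t j|}).measurableSet

/-- Integrating out the inputs of round `t` alone fixes the past, hence `P_t`, and makes the picks
of that round i.i.d.; Hoeffding then gives a bound uniform in the other inputs. -/
lemma seedsLaw_empFreq_ge_le (hB : 0 ≤ B) (hN₂ : N₂ ≠ 0) (hsel : Measurable sel) {η ε : ℝ}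
    (hη : 0 < η) (hε : 0 ≤ ε) (t : Fin T) (j : Fin K) :
    seedsLaw d n T K N₁ N₂ B η {s |
      ε ≤ |empFreq (picks B sel s t) j - pickProb d n N₁ B η sel (picks B sel s) t j|} ≤
      ENNReal.ofReal (2 * Real.exp (-2 * N₂ * ε ^ 2)) := by
  have hp := isProbabilityMeasure_callLaw (d := d) (n := n) (T := T) (K := K) (N₁ := N₁) (B := B) hη
  set A := {s : Seeds d n T K N₁ N₂ |
      ε ≤ |empFreq (picks B sel s t) j - pickProb d n N₁ B η sel (picks B sel s) t j|} with hA
  have hAm : MeasurableSet A := measurableSet_empFreq_ge hB hN₂ hsel η ε t j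
  have hpi : IsProbabilityMeasure (seedsLaw d n T K N₁ N₂ B η) := by
    unfold seedsLaw; infer_instance
  have key := lintegral_le_of_lmarginal_le
    (μ := fun _ : Fin T => Measure.pi fun _ : Fin N₂ => callLaw d n T K N₁ B η) {t}
    (f := A.indicator 1)
    (g := fun _ => ENNReal.ofReal (2 * Real.exp (-2 * N₂ * ε ^ 2)))
    (measurable_one.indicator hAm) measurable_const ?_
  · rw [lintegral_indicator_one hAm] at key
    refine key.trans_eq ?_
    rw [lintegral_const]
    change _ * seedsLaw d n T K N₁ N₂ B η Set.univ = _
    rw [measure_univ, mul_one]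
  · rw [lmarginal_singleton, lmarginal_singleton]
    intro s
    simp only [lintegral_const, measure_univ, mul_one]
    set X : CallSeed d n T K N₁ → ℝ :=
      fun c => if callPick B sel (picks B sel s) t c = j then (1 : ℝ) else 0 with hX
    have hms : MeasurableSet {c : CallSeed d n T K N₁ | callPick B sel (picks B sel s) t c = j} :=
      measurable_callPick hB hN₂ hsel _ t (measurableSet_singleton j)
    have hXm : Measurable X := Measurable.ite hms measurable_const measurable_const
    have hXi : ∫ c, X c ∂(callLaw d n T K N₁ B η) =
        pickProb d n N₁ B η sel (picks B sel s) t j := by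
      have : X = {c : CallSeed d n T K N₁ |
          callPick B sel (picks B sel s) t c = j}.indicator 1 := by
        funext c; simp [hX, Set.indicator_apply]
      rw [this, integral_indicator_one hms]; rfl
    have hearlier : ∀ (y : Fin N₂ → CallSeed d n T K N₁), ∀ i < t,
        picks B sel (Function.update s t y) i = picks B sel s i := fun y i hi =>
      picks_congr i fun i' hi' => Function.update_of_ne (hi'.trans_lt hi).ne _ _
    have hmem : ∀ y : Fin N₂ → CallSeed d n T K N₁, Function.update s t y ∈ A ↔
        ε ≤ |(∑ k, X (y k)) / N₂ - ∫ c, X c ∂(callLaw d n T K N₁ B η)| := fun y => by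
      rw [hXi, hA, Set.mem_ofPred_eq]
      have h1 : pickProb d n N₁ B η sel (picks B sel (Function.update s t y)) t j =
          pickProb d n N₁ B η sel (picks B sel s) t j := by
        unfold pickProb
        simp_rw [callPick_congr (hearlier y)]
      have h2 : empFreq (picks B sel (Function.update s t y) t) j = (∑ k, X (y k)) / N₂ := by
        unfold empFreq
        congr 1
        refine Finset.sum_congr rfl fun k _ => ?_
        rw [picks_apply, callPick_congr (hearlier y), Function.update_self]
      rw [h1, h2]
    have hh := pi_abs_mean_sub_ge_le (callLaw d n T K N₁ B η) hXm
      (fun c => by simp only [hX]; split_ifs <;> simp) hN₂ hε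
    have hset : {y : Fin N₂ → CallSeed d n T K N₁ |
        ε ≤ |(∑ k, X (y k)) / N₂ - ∫ c, X c ∂(callLaw d n T K N₁ B η)|} =
        Function.update s t ⁻¹' A := by
      ext y; exact (hmem y).symm
    rw [hset] at hh
    have hAm' : MeasurableSet (Function.update s t ⁻¹' A) := (measurable_update s) hAm
    have : ∀ y, A.indicator (1 : Seeds d n T K N₁ N₂ → ENNReal) (Function.update s t y) =
        (Function.update s t ⁻¹' A).indicator 1 y := fun _ => rfl
    simp_rw [this]
    rw [lintegral_indicator_one hAm']
    exact (ENNReal.le_ofReal_iff_toReal_le (measure_ne_top _ _) (by positivity)).2 hh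

/-- With high probability all the empirical frequencies are close to the probabilities. -/
lemma seedsLaw_exists_empFreq_ge_le (hB : 0 ≤ B) (hN₂ : N₂ ≠ 0) (hsel : Measurable sel) {η ε : ℝ}
    (hη : 0 < η) (hε : 0 ≤ ε) :
    seedsLaw d n T K N₁ N₂ B η {s | ∃ t j,
      ε ≤ |empFreq (picks B sel s t) j - pickProb d n N₁ B η sel (picks B sel s) t j|} ≤
      ENNReal.ofReal (T * K * (2 * Real.exp (-2 * N₂ * ε ^ 2))) := by
  have h : {s : Seeds d n T K N₁ N₂ | ∃ t j,
      ε ≤ |empFreq (picks B sel s t) j - pickProb d n N₁ B η sel (picks B sel s) t j|} =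
      ⋃ t, ⋃ j, {s |
        ε ≤ |empFreq (picks B sel s t) j - pickProb d n N₁ B η sel (picks B sel s) t j|} := by
    ext s; simp
  rw [h]
  refine (measure_iUnion_fintype_le _ _).trans ?_
  refine (Finset.sum_le_sum fun t _ => (measure_iUnion_fintype_le _ _).trans
    (Finset.sum_le_sum fun j _ => seedsLaw_empFreq_ge_le hB hN₂ hsel hη hε t j)).trans_eq ?_
  simp only [Finset.sum_const, Finset.card_univ, Fintype.card_fin, nsmul_eq_mul]
  rw [ENNReal.ofReal_mul (p := (T : ℝ) * K) (by positivity),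
    ENNReal.ofReal_mul (p := (T : ℝ)) (by positivity), ENNReal.ofReal_natCast, ENNReal.ofReal_natCast]
  ring

/-! ### Regret of the maximization oracle -/

lemma sum_subtype_lt_eq_sum_range (g : Fin T → ℝ) (t : Fin T) :
    ∑ i : {i : Fin T // i < t}, g i.1 =
      ∑ m ∈ Finset.range t, if hm : m < T then g ⟨m, hm⟩ else 0 := by
  refine Finset.sum_bij (fun i _ => i.1.1) (fun i _ => Finset.mem_range.2 i.2)
    (fun i _ i' _ h => Subtype.ext (Fin.ext h))
    (fun m hm => ⟨⟨⟨m, (Finset.mem_range.1 hm).trans t.2⟩, Finset.mem_range.1 hm⟩,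
      Finset.mem_univ _, rfl⟩) fun i _ => ?_
  rw [dif_pos i.1.2]

lemma integral_comp_fin {Ω : Type*} [MeasurableSpace Ω] {ρ : Measure Ω} [IsFiniteMeasure ρ]
    {X : Ω → Fin K} (hX : Measurable X) (φ : Fin K → ℝ) :
    ∫ c, φ (X c) ∂ρ = ∑ j, ρ.real {c | X c = j} * φ j := by
  rw [← integral_map hX.aemeasurable (measurable_of_countable φ).aestronglyMeasurable,
    integral_fintype (.of_finite)]
  refine Finset.sum_congr rfl fun j _ => ?_
  rw [map_measureReal_apply hX (measurableSet_singleton j), smul_eq_mul]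
  rfl

/-- The bound on the cumulative regret of the maximization oracle. -/
def regretBound (n T K N₁ : ℕ) (B η a : ℝ) : ℝ :=
  B / η + T * (2 * (4 * (B * (B * √n + 1))) *
    ((Real.exp (η * (2 * (4 * (B * (B * √n + 1))))) - 1) * B) +
      6 * (a / 2 + K * (4 * B ^ 4 / N₁) / (2 * a)))

/-- For a frozen history `h` the risks are a fixed sequence of Lipschitz losses and the oracle is a
noisy perturbed leader. Being true for every `h`, the bound can be used at the random history of the
run. -/
lemma sum_risk_le_sum_pickProb (hB : 0 < B) (hN₁ : N₁ ≠ 0) (hN₂ : N₂ ≠ 0)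
    (hsel : IsArgmaxRule sel) {η a : ℝ} (hη : 0 < η) (ha : 0 < a) (h : Fin T → Fin N₂ → Fin K)
    (j : Fin K) :
    ∑ t, risk (gridEstimator d n B (h t)) (axisVec d (gridPoint B K j)) ≤
      ∑ t, ∑ j', pickProb d n N₁ B η sel h t j' *
        risk (gridEstimator d n B (h t)) (axisVec d (gridPoint B K j')) +
      regretBound n T K N₁ B η a := by
  have hp := isProbabilityMeasure_callLaw (d := d) (n := n) (T := T) (K := K) (N₁ := N₁) (B := B) hη
  have hest := fun t => isEstimator_gridEstimator (d := d) (n := n) hB.le hN₂ (h t)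
  have hmem : ∀ j : Fin K, axisVec d (gridPoint B K j) ∈ closedBall (0 : Vec d) B := fun j =>
    axisVec_mem (abs_gridPoint_le hB.le j)
  have hL : 0 < 4 * (B * (B * √n + 1)) := by positivity
  -- Losses of rounds beyond `T` are set to zero, so that rounds can be indexed by `ℕ`.
  set f : ℕ → Fin K → ℝ := fun i j => if hi : i < T then
    risk (gridEstimator d n B (h ⟨i, hi⟩)) (axisVec d (gridPoint B K j)) else 0 with hf
  set F : ℕ → (Fin T × Fin K × Fin N₁ → Data d n) → Fin K → ℝ := fun i ω j => if hi : i < T then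
    estimatedRisk B (h ⟨i, hi⟩) ⟨i, hi⟩ j ω else 0 with hF
  have hvar : ∀ (i : Fin T) (j : Fin K), _ := fun i j =>
    integral_empRisk_sub_sq_le hN₁ (hest i) (hmem j)
      (fun q : Fin T × Fin K × Fin N₁ => axisVec d (gridPoint B K q.2.1))
      (e := fun m => (i, j, m)) (fun m m' hm => by simpa using hm) (fun m => rfl)
  have key := integral_perturbed_leader_regret (b := gridPoint B K)
    (Measure.pi fun q : Fin T × Fin K × Fin N₁ => dataLaw n (axisVec d (gridPoint B K q.2.1)))
    (V := 4 * B ^ 4 / N₁) hη hL ha hsel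
    (gridPoint_nonneg hB.le) (gridPoint_le hB.le) (f := f) (fun i j j' => ?_) (F := F)
    (fun i => ?_) (fun i j => ?_) (fun i j => ?_) T j
  · have hf' : ∀ t : Fin T, f t = fun j =>
        risk (gridEstimator d n B (h t)) (axisVec d (gridPoint B K j)) := fun t => by
      funext j; simp [hf]
    have hpick : ∀ (t : Fin T) (c : CallSeed d n T K N₁),
        (sel fun j => ∑ m ∈ Finset.range t, F m c.2 j + c.1 * gridPoint B K j) =
          callPick B sel h t c := fun t c => by
      unfold callPick
      congr 1
      funext j
      rw [sum_subtype_lt_eq_sum_range (fun i => estimatedRisk B (h i) i j c.2)]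
    rw [← Fin.sum_univ_eq_sum_range (fun i => f i j), ← Fin.sum_univ_eq_sum_range (fun i =>
      ∫ c : ℝ × (Fin T × Fin K × Fin N₁ → Data d n),
        f i (sel fun j => ∑ m ∈ Finset.range i, F m c.2 j + c.1 * gridPoint B K j)
          ∂((expMeasure η).prod (Measure.pi fun q : Fin T × Fin K × Fin N₁ =>
            dataLaw n (axisVec d (gridPoint B K q.2.1)))))] at key
    simp_rw [hpick] at key
    have hint : ∀ t : Fin T, ∫ c, f t (callPick B sel h t c) ∂(callLaw d n T K N₁ B η) =
        ∑ j', pickProb d n N₁ B η sel h t j' *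
          risk (gridEstimator d n B (h t)) (axisVec d (gridPoint B K j')) := fun t => by
      rw [integral_comp_fin (measurable_callPick hB.le hN₂ hsel.1 h t), hf' t]
      rfl
    simp_rw [← hint]
    simp_rw [hf'] at key ⊢
    exact key
  · simp only [hf]
    split_ifs with hi
    · refine ((hest ⟨i, hi⟩).risk_sub_le (hmem j) (hmem j')).trans_eq ?_
      rw [axisVec, axisVec, ← sub_smul, norm_smul]
      simp
    · simp only [sub_self]; positivity
  · refine measurable_pi_lambda _ fun j => ?_
    simp only [hF]
    split_ifs with hi
    · exact measurable_estimatedRisk hB.le hN₂ _ _ _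
    · exact measurable_const
  · simp only [hF, hf]
    split_ifs with hi
    · exact (hvar ⟨i, hi⟩ j).1
    · simp
  · simp only [hF, hf]
    split_ifs with hi
    · exact (hvar ⟨i, hi⟩ j).2
    · simp only [sub_self]
      rw [zero_pow two_ne_zero, integral_zero]
      positivity

/-! ### From regret to worst-case risk -/

lemma risk_gridEstimator_eq_of_norm_eq (hB : 0 ≤ B) (hN₂ : N₂ ≠ 0) (v : Fin N₂ → Fin K)
    {θ θ' : Vec d} (h : ‖θ‖ = ‖θ'‖) :
    risk (gridEstimator d n B v) θ = risk (gridEstimator d n B v) θ' := by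
  have := isProbabilityMeasure_empMeasure hN₂ fun k => gridPoint B K (v k)
  have he : (gridEstimator d n B v) =
      posteriorMean (radialExtension d (empMeasure fun k => gridPoint B K (v k))) :=
    funext fun D => fbEstimator_eq_posteriorMean hN₂ _ D
  rw [he]
  exact risk_posteriorMean_eq_of_norm_eq _
    (ae_mem_radialExtension_empMeasure fun _ => abs_gridPoint_le hB _) h

/-- The Bayes risk of the empirical prior of the grid positions `v`, which is attained by the
minimization oracle. -/
lemma sum_empFreq_mul_risk_eq_bayesRisk (hB : 0 ≤ B) (hN₂ : N₂ ≠ 0) (v : Fin N₂ → Fin K) :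
    ∑ j, empFreq v j * risk (gridEstimator d n B v) (axisVec d (gridPoint B K j)) =
      bayesRisk n B (radialExtension d (empMeasure fun k => gridPoint B K (v k))) := by
  have := isProbabilityMeasure_empMeasure hN₂ fun k => gridPoint B K (v k)
  have he : (gridEstimator d n B v) =
      posteriorMean (radialExtension d (empMeasure fun k => gridPoint B K (v k))) :=
    funext fun D => fbEstimator_eq_posteriorMean hN₂ _ D
  rw [bayesRisk_eq_integral_risk_posteriorMean hB
    (ae_mem_radialExtension_empMeasure fun _ => abs_gridPoint_le hB _), ← he,
    integral_radialExtension_empMeasure _ (isEstimator_gridEstimator hB hN₂ v).continuous_risk]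
  have h1 : ∀ k : Fin N₂, ∫ Z : sphere (0 : Vec d) 1,
      risk (gridEstimator d n B v) (gridPoint B K (v k) • (Z : Vec d)) ∂(uniformSphere d) =
      risk (gridEstimator d n B v) (axisVec d (gridPoint B K (v k))) := fun k => by
    have : ∀ Z : sphere (0 : Vec d) 1,
        risk (gridEstimator d n B v) (gridPoint B K (v k) • (Z : Vec d)) =
        risk (gridEstimator d n B v) (axisVec d (gridPoint B K (v k))) := fun Z =>
      risk_gridEstimator_eq_of_norm_eq hB hN₂ v (by rw [norm_axisVec, norm_smul]; simp)
    simp [this]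
  simp_rw [h1]
  unfold empFreq
  simp_rw [div_mul_eq_mul_div, Finset.sum_mul, ite_mul, one_mul, zero_mul]
  rw [← Finset.sum_div, Finset.sum_comm, smul_eq_mul, div_eq_inv_mul]
  simp

lemma avgEstimator_eq (s : Seeds d n T K N₁ N₂) (D : Data d n) :
    avgEstimator B sel s D = (T : ℝ)⁻¹ • ∑ t, gridEstimator d n B (picks B sel s t) D := rfl

lemma isEstimator_avgEstimator (hB : 0 ≤ B) (hT : T ≠ 0) (hN₂ : N₂ ≠ 0)
    (s : Seeds d n T K N₁ N₂) : IsEstimator B (avgEstimator B sel s) := by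
  have hest := fun t => isEstimator_gridEstimator (d := d) (n := n) hB hN₂ (picks B sel s t)
  refine ⟨?_, fun D => ?_⟩
  · have hsum : Measurable fun D => ∑ t, gridEstimator d n B (picks B sel s t) D :=
      Finset.measurable_fun_sum _ fun t _ => (hest t).1
    exact hsum.const_smul (T : ℝ)⁻¹
  · have hT' : (0 : ℝ) < T := Nat.cast_pos.2 (Nat.pos_of_ne_zero hT)
    rw [mem_closedBall_zero_iff, avgEstimator_eq, norm_smul, norm_inv, Real.norm_natCast,
      inv_mul_le_iff₀ hT']
    refine (norm_sum_le_of_le _ fun t _ => mem_closedBall_zero_iff.1 ((hest t).2 D)).trans_eq ?_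
    simp

/-- Jensen's inequality for the squared distance, applied to each data set. -/
lemma risk_avgEstimator_le (hB : 0 ≤ B) (hT : T ≠ 0) (hN₂ : N₂ ≠ 0) (s : Seeds d n T K N₁ N₂)
    {θ : Vec d} (hθ : θ ∈ closedBall (0 : Vec d) B) :
    risk (avgEstimator B sel s) θ ≤
      (T : ℝ)⁻¹ * ∑ t, risk (gridEstimator d n B (picks B sel s t)) θ := by
  have hest := fun t => isEstimator_gridEstimator (d := d) (n := n) hB hN₂ (picks B sel s t)
  have hi := fun t => (hest t).integrable_loss hθ (dataLaw n θ)
  have hT' : (0 : ℝ) < T := Nat.cast_pos.2 (Nat.pos_of_ne_zero hT)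
  unfold risk
  rw [← integral_finsetSum _ fun t _ => hi t, ← integral_const_mul]
  refine integral_mono ((isEstimator_avgEstimator hB hT hN₂ s).integrable_loss hθ _)
    ((integrable_finsetSum _ fun t _ => hi t).const_mul _) fun D => ?_
  have h1 : avgEstimator B sel s D - θ =
      (T : ℝ)⁻¹ • ∑ t, (gridEstimator d n B (picks B sel s t) D - θ) := by
    rw [avgEstimator_eq, Finset.sum_sub_distrib, smul_sub, Finset.sum_const, Finset.card_univ,
      Fintype.card_fin, ← Nat.cast_smul_eq_nsmul ℝ, smul_smul, inv_mul_cancel₀ hT'.ne', one_smul]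
  simp only
  rw [h1, norm_smul, mul_pow, norm_inv, Real.norm_natCast, inv_pow, inv_mul_le_iff₀ (by positivity),
    sq (T : ℝ), mul_assoc, mul_inv_cancel_left₀ hT'.ne']
  refine (pow_le_pow_left₀ (norm_nonneg _) (norm_sum_le _ _) 2).trans ?_
  have := sq_sum_le_card_mul_sum_sq (s := Finset.univ)
    (f := fun t : Fin T => ‖gridEstimator d n B (picks B sel s t) D - θ‖)
  simpa using this

/-- Every radius is close to a grid point. -/
lemma exists_gridPoint_close (hB : 0 < B) (hK : K ≠ 0) {r : ℝ} (h0 : 0 ≤ r) (hr : r ≤ B) :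
    ∃ j : Fin K, |r - gridPoint B K j| ≤ B / K := by
  have hK' : (0 : ℝ) < K := Nat.cast_pos.2 (Nat.pos_of_ne_zero hK)
  have hq : 0 ≤ r * K / B := by positivity
  have hBK : 0 < B / K := by positivity
  have hfl := Nat.floor_le hq
  have hlt := Nat.lt_floor_add_one (r * K / B)
  have hr' : r = r * K / B * (B / K) := by field_simp
  -- Index `j` stands for the radius `(j + 1) B / K`, so this index selects the next grid point
  -- above `r`; it is out of range only for `r = B`, which is the last grid point.
  rcases lt_or_ge ⌊r * K / B⌋₊ K with h | h
  · refine ⟨⟨⌊r * K / B⌋₊, h⟩, ?_⟩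
    have hg : gridPoint B K ⟨⌊r * K / B⌋₊, h⟩ = (⌊r * K / B⌋₊ + 1 : ℝ) * (B / K) := by
      rw [gridPoint]; ring
    rw [hg]
    refine abs_le.2 ⟨?_, ?_⟩
    · have := mul_le_mul_of_nonneg_right hfl hBK.le
      linarith
    · have := mul_le_mul_of_nonneg_right hlt.le hBK.le
      linarith
  · refine ⟨⟨K - 1, by omega⟩, ?_⟩
    have hg : gridPoint B K ⟨K - 1, by omega⟩ = B := by
      rw [gridPoint]
      have : ((K - 1 : ℕ) : ℝ) = K - 1 := by
        rw [Nat.cast_sub (Nat.one_le_iff_ne_zero.2 hK)]; simp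
      simp only [this]
      field_simp
      ring
    have hrB : r = B := by
      refine le_antisymm hr ?_
      have h1 : (K : ℝ) ≤ r * K / B := (Nat.cast_le.2 h).trans hfl
      rw [le_div_iff₀ hB] at h1
      exact le_of_mul_le_mul_left (by linarith) hK'
    rw [hg, hrB, sub_self, abs_zero]
    exact hBK.le

/-- The worst-case risk of the averaged estimator is at most the average of the Bayes risks of the
empirical priors plus the error of the run. -/
lemma worstRisk_avgEstimator_le (hB : 0 < B) (hT : T ≠ 0) (hK : K ≠ 0) (hN₁ : N₁ ≠ 0)
    (hN₂ : N₂ ≠ 0) (hsel : IsArgmaxRule sel) {η a ε : ℝ} (hη : 0 < η) (ha : 0 < a)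
    (s : Seeds d n T K N₁ N₂)
    (hs : ∀ t j, |empFreq (picks B sel s t) j - pickProb d n N₁ B η sel (picks B sel s) t j| ≤ ε) :
    worstRisk B (avgEstimator B sel s) ≤
      (T : ℝ)⁻¹ * ∑ t, bayesRisk n B (radialExtension d (empMeasure (radii B sel s t))) +
      (K * (ε * (4 * B ^ 2)) + (T : ℝ)⁻¹ * regretBound n T K N₁ B η a +
        4 * (B * (B * √n + 1)) * (B / K)) := by
  have hT' : (0 : ℝ) < T := Nat.cast_pos.2 (Nat.pos_of_ne_zero hT)
  have hest := fun t => isEstimator_gridEstimator (d := d) (n := n) hB.le hN₂ (picks B sel s t)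
  have hmem : ∀ j : Fin K, axisVec d (gridPoint B K j) ∈ closedBall (0 : Vec d) B := fun j =>
    axisVec_mem (abs_gridPoint_le hB.le j)
  have : Nonempty (closedBall (0 : Vec d) B) := ⟨⟨0, mem_closedBall_self hB.le⟩⟩
  refine ciSup_le fun ⟨θ, hθ⟩ => ?_
  have hθ' := mem_closedBall_zero_iff.1 hθ
  obtain ⟨j, hj⟩ := exists_gridPoint_close hB hK (norm_nonneg θ) hθ'
  have hnθ : |‖θ‖| ≤ B := by rwa [abs_norm]
  -- Rotate `θ` onto the axis, then use the Lipschitz bound along it.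
  have h1 : ∀ t, risk (gridEstimator d n B (picks B sel s t)) θ ≤
      risk (gridEstimator d n B (picks B sel s t)) (axisVec d (gridPoint B K j)) +
        4 * (B * (B * √n + 1)) * (B / K) := fun t => by
    rw [risk_gridEstimator_eq_of_norm_eq hB.le hN₂ _
      (show ‖θ‖ = ‖axisVec d ‖θ‖‖ by rw [norm_axisVec, abs_norm])]
    have h2 := (hest t).risk_sub_le (axisVec_mem hnθ) (hmem j)
    have h3 : ‖axisVec d ‖θ‖ - axisVec d (gridPoint B K j)‖ ≤ B / K := by
      rw [axisVec, axisVec, ← sub_smul, norm_smul]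
      simpa using hj
    have h4 : 0 ≤ 4 * (B * (B * √(n : ℝ) + 1)) := by positivity
    linarith [mul_le_mul_of_nonneg_left h3 h4]
  have h2 := sum_risk_le_sum_pickProb (d := d) (n := n) (N₁ := N₁) hB hN₁ hN₂ hsel hη ha
    (fun t => picks B sel s t) j
  -- Passing from `P_t` to `P̂_t` costs `ε` at each of the `K` grid points, times the largest
  -- possible risk `4B²`.
  have h3 : ∀ t, ∑ j', pickProb d n N₁ B η sel (picks B sel s) t j' *
      risk (gridEstimator d n B (picks B sel s t)) (axisVec d (gridPoint B K j')) ≤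
      bayesRisk n B (radialExtension d (empMeasure (radii B sel s t))) +
        K * (ε * (4 * B ^ 2)) := fun t => by
    have h4 := sum_empFreq_mul_risk_eq_bayesRisk (d := d) (n := n) hB.le hN₂ (picks B sel s t)
    change _ = bayesRisk n B (radialExtension d (empMeasure (radii B sel s t))) at h4
    rw [← h4]
    have h5 : (K : ℝ) * (ε * (4 * B ^ 2)) = ∑ _j : Fin K, ε * (4 * B ^ 2) := by simp
    rw [h5, ← Finset.sum_add_distrib]
    refine Finset.sum_le_sum fun j' _ => ?_
    have h6 := (hest t).risk_le (hmem j')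
    have h7 := risk_nonneg (gridEstimator d n B (picks B sel s t)) (axisVec d (gridPoint B K j'))
    have h8 := (abs_le.1 (hs t j')).1
    have hε : 0 ≤ ε := (abs_nonneg _).trans (hs t j')
    nlinarith [mul_le_mul_of_nonneg_left h6 hε]
  refine (risk_avgEstimator_le hB.le hT hN₂ s hθ).trans ?_
  have h4 : ∑ t, risk (gridEstimator d n B (picks B sel s t)) θ ≤
      ∑ t, bayesRisk n B (radialExtension d (empMeasure (radii B sel s t))) +
        T * (K * (ε * (4 * B ^ 2))) + regretBound n T K N₁ B η a +
        T * (4 * (B * (B * √n + 1)) * (B / K)) := by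
    have h5 := Finset.sum_le_sum fun t (_ : t ∈ Finset.univ) => h1 t
    have h6 := Finset.sum_le_sum fun t (_ : t ∈ Finset.univ) => h3 t
    rw [Finset.sum_add_distrib] at h5 h6
    simp only [Finset.sum_const, Finset.card_univ, Fintype.card_fin, nsmul_eq_mul] at h5 h6
    linarith
  refine (mul_le_mul_of_nonneg_left h4 (inv_nonneg.2 hT'.le)).trans_eq ?_
  field_simp
  ring

lemma bayesRisk_empMeasure_le_minimaxRisk (hB : 0 < B) (hN₂ : N₂ ≠ 0)
    (s : Seeds d n T K N₁ N₂) (t : Fin T) :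
    bayesRisk n B (radialExtension d (empMeasure (radii B sel s t))) ≤ minimaxRisk d n B := by
  have := isProbabilityMeasure_empMeasure hN₂ (radii B sel s t)
  exact bayesRisk_le_minimaxRisk hB
    (ae_mem_radialExtension_empMeasure fun k => abs_gridPoint_le hB.le _)

/-- The Bayes risk is concave in the prior. -/
lemma avg_bayesRisk_le_bayesRisk_avgPrior (hB : 0 ≤ B) (hN₂ : N₂ ≠ 0)
    (s : Seeds d n T K N₁ N₂) :
    (T : ℝ)⁻¹ * ∑ t, bayesRisk n B (radialExtension d (empMeasure (radii B sel s t))) ≤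
      bayesRisk n B (radialExtension d (avgPrior B sel s)) := by
  have := nonempty_estimator (d := d) (n := n) hB
  have hprob := fun t => isProbabilityMeasure_empMeasure hN₂ (radii B sel s t)
  -- For fixed `f` the integrated risk is linear in the prior, and the Bayes risk is an infimum of
  -- such functionals.
  refine le_ciInf fun f => ?_
  unfold avgPrior
  have hsf : SFinite (∑ t, empMeasure (radii B sel s t)) := by
    rw [← Measure.sum_fintype]; infer_instance
  rw [radialExtension_smul, radialExtension_sum, integral_smul_measure,
    integral_finsetSum_measure fun t _ => integrable_radialExtension_empMeasure hN₂ _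
      f.isEstimator.continuous_risk]
  simp only [ENNReal.toReal_inv, ENNReal.toReal_natCast, smul_eq_mul]
  gcongr with t _
  exact bayesRisk_le f.isEstimator

/-! ### Numerical bounds for the chosen parameters -/

/-- The error of the run, for the parameters of the algorithm, with all quantities written in terms
of `S = √T` and `Λ = B √n + 1`. -/
lemma run_error_le {B Λ S K N₁ x : ℝ} (hB : 0 < B) (hΛ : 0 < Λ) (hS : 1 ≤ S) (hx : 1 ≤ x)
    (hK : S ^ 3 ≤ K) (hK' : K ≤ 2 * S ^ 3) (hN₁ : S ^ 6 / Λ ^ 2 ≤ N₁) :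
    K * (2 * x * Λ / S ^ 4 * (4 * B ^ 2)) +
      (S ^ 2)⁻¹ * (B / (1 / (B * Λ * S)) + S ^ 2 * (2 * (4 * (B * Λ)) *
        ((Real.exp (1 / (B * Λ * S) * (2 * (4 * (B * Λ)))) - 1) * B) +
          6 * (B ^ 2 * Λ / S / 2 + K * (4 * B ^ 4 / N₁) / (2 * (B ^ 2 * Λ / S))))) +
      4 * (B * Λ) * (B / K) ≤
    (48 + 64 * Real.exp 8) * (B ^ 2 * Λ / S) * x := by
  have hS0 : 0 < S := one_pos.trans_le hS
  have hK0 : 0 < K := (pow_pos hS0 3).trans_le hK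
  set u := B ^ 2 * Λ / S with hu
  have hu0 : 0 < u := by positivity
  have h1 : K * (2 * x * Λ / S ^ 4 * (4 * B ^ 2)) ≤ 16 * u * x := by
    calc _ ≤ 2 * S ^ 3 * (2 * x * Λ / S ^ 4 * (4 * B ^ 2)) := by gcongr
      _ = _ := by rw [hu]; field_simp; ring
  have h2 : (S ^ 2)⁻¹ * (B / (1 / (B * Λ * S))) = u := by rw [hu]; field_simp
  have h3 : 2 * (4 * (B * Λ)) * ((Real.exp (1 / (B * Λ * S) * (2 * (4 * (B * Λ)))) - 1) * B) ≤
      64 * Real.exp 8 * u := by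
    have he : 1 / (B * Λ * S) * (2 * (4 * (B * Λ))) = 8 / S := by field_simp; norm_num
    -- `1 - exp (-y) ≤ y` multiplied by `exp y`, where `y = 8 / S ≤ 8`.
    have hle : Real.exp (8 / S) - 1 ≤ 8 / S * Real.exp 8 := by
      have h4 := Real.add_one_le_exp (-(8 / S))
      have h5 : Real.exp (8 / S) ≤ Real.exp 8 :=
        Real.exp_le_exp.2 (div_le_self (by norm_num) hS)
      have h6 : Real.exp (-(8 / S)) * Real.exp (8 / S) = 1 := by rw [← Real.exp_add]; simp
      have h7 := mul_le_mul_of_nonneg_right h4 (Real.exp_pos (8 / S)).le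
      have h8 := mul_le_mul_of_nonneg_left h5 (show 0 ≤ 8 / S by positivity)
      linarith
    rw [he]
    calc _ ≤ 2 * (4 * (B * Λ)) * (8 / S * Real.exp 8 * B) := by gcongr
      _ = _ := by rw [hu]; field_simp; ring
  have hN₁0 : 0 < N₁ := lt_of_lt_of_le (by positivity) hN₁
  have h4 : K * (4 * B ^ 4 / N₁) / (2 * u) ≤ 4 * u := by
    calc _ ≤ 2 * S ^ 3 * (4 * B ^ 4 / (S ^ 6 / Λ ^ 2)) / (2 * u) := by gcongr
      _ = 4 * (u / S) := by rw [hu]; field_simp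
      _ ≤ 4 * u := by gcongr; exact div_le_self hu0.le hS
  have h5 : 4 * (B * Λ) * (B / K) ≤ 4 * u := by
    have hSK : S ≤ K := (le_self_pow₀ hS (by norm_num)).trans hK
    calc _ ≤ 4 * (B * Λ) * (B / S) := by gcongr
      _ = _ := by rw [hu]; field_simp
  have h6 : ∀ y z : ℝ, (S ^ 2)⁻¹ * (y + S ^ 2 * z) = (S ^ 2)⁻¹ * y + z := fun y z => by
    rw [mul_add, inv_mul_cancel_left₀ (by positivity)]
  rw [h6, h2]
  -- `32 = 1 + 6 (1/2 + 4) + 4`: the perturbation, the Monte Carlo noise and the grid. The sampling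
  -- error supplies the remaining `16`.
  have h7 : (32 + 64 * Real.exp 8) * u ≤ (32 + 64 * Real.exp 8) * u * x :=
    le_mul_of_one_le_right (by positivity) hx
  linarith

/-- The failure probability of the run, for the parameters of the algorithm. -/
lemma failure_probability_le {T K N₂ Λ δ : ℝ} (hT : 1 ≤ T) (hΛ : 0 < Λ) (hδ : 0 < δ) (hδ' : δ < 1)
    (hK : K ≤ 2 * T ^ 2) (hN₂ : T ^ 4 / Λ ^ 2 ≤ N₂) :
    T * K * (2 * Real.exp (-2 * N₂ * (2 * (1 + Real.log (T / δ)) * Λ / T ^ 2) ^ 2)) ≤ δ := by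
  have hT0 : 0 < T := one_pos.trans_le hT
  have hq : 1 ≤ T / δ := (one_le_div hδ).2 (hδ'.le.trans hT)
  set x := 1 + Real.log (T / δ) with hx
  have hx1 : 1 ≤ x := le_add_of_nonneg_right (Real.log_nonneg hq)
  -- The factor `4` yields `(δ/T)⁴`, which absorbs the union bound over `T K ≤ 2 T³` events.
  have h1 : 4 * x ≤ 2 * N₂ * (2 * x * Λ / T ^ 2) ^ 2 := by
    calc 4 * x ≤ 8 * x ^ 2 := by nlinarith
      _ = 2 * (T ^ 4 / Λ ^ 2) * (2 * x * Λ / T ^ 2) ^ 2 := by field_simp; ring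
      _ ≤ _ := by gcongr
  have h2 : Real.exp (-2 * N₂ * (2 * x * Λ / T ^ 2) ^ 2) ≤ 1 / 4 * (δ / T) ^ 4 := by
    calc _ ≤ Real.exp (-(4 * x)) := Real.exp_le_exp.2 (by linarith)
      _ = Real.exp (-4) * (δ / T) ^ 4 := by
        rw [show -(4 * x) = -4 + (4 : ℕ) * Real.log (δ / T) by
          rw [hx, ← inv_div δ T, Real.log_inv]; push_cast; ring, Real.exp_add, Real.exp_nat_mul,
          Real.exp_log (by positivity)]
      _ ≤ _ := by
        gcongr
        rw [Real.exp_neg, one_div]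
        refine inv_anti₀ (by norm_num) ?_
        linarith [Real.add_one_le_exp (4 : ℝ)]
  calc _ ≤ T * (2 * T ^ 2) * (2 * (1 / 4 * (δ / T) ^ 4)) := by gcongr
    _ = δ * (δ ^ 3 / T) := by field_simp; ring
    _ ≤ δ * 1 := by
      gcongr
      rw [div_le_one hT0]
      exact (pow_le_one₀ hδ.le hδ'.le).trans hT
    _ = δ := mul_one δ

/-- A set that contains the complement of a set of measure at most `δ` has measure at least
`1 - δ`. -/
lemma ofReal_one_sub_le_of_compl_subset {Ω : Type*} [MeasurableSpace Ω] (μ : Measure Ω)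
    [IsProbabilityMeasure μ] {s t : Set Ω} {δ : ℝ} (hδ : 0 ≤ δ) (ht : μ t ≤ ENNReal.ofReal δ)
    (h : tᶜ ⊆ s) : ENNReal.ofReal (1 - δ) ≤ μ s := by
  have h1 : (1 : ENNReal) ≤ μ s + ENNReal.ofReal δ := by
    calc (1 : ENNReal) = μ Set.univ := measure_univ.symm
      _ ≤ μ (s ∪ t) := measure_mono fun x _ => by
        by_cases hx : x ∈ t
        · exact Or.inr hx
        · exact Or.inl (h hx)
      _ ≤ μ s + μ t := measure_union_le _ _
      _ ≤ _ := by gcongr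
  rw [ENNReal.ofReal_sub _ hδ, ENNReal.ofReal_one]
  exact tsub_le_iff_right.2 h1

end RegressionGame

end

/-! ### The main theorem -/

open RegressionGame

theorem theorem6 :
    ∃ (C : ℝ) (p : ℕ), 0 < C ∧
      ∀ (d n T : ℕ) [NeZero d] (B δ : ℝ), 1 ≤ n → 1 ≤ T → 0 < B → 0 < δ → δ < 1 →
      ∀ (η w : ℝ) (K N₁ N₂ : ℕ),
        η = 1 / (B * (B * √(n : ℝ) + 1) * √(T : ℝ)) →
        w = B / (T : ℝ) ^ (3 / 2 : ℝ) →
        K = ⌈B / w⌉₊ →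
        N₁ = ⌈(T : ℝ) ^ 3 / (B * √(n : ℝ) + 1) ^ 2⌉₊ →
        N₂ = ⌈(T : ℝ) ^ 4 / (B * √(n : ℝ) + 1) ^ 2⌉₊ →
      ∀ sel : (Fin K → ℝ) → Fin K, RegressionGame.IsArgmaxRule sel →
        -- the averaged estimator is always a deterministic estimator
        (∀ s : RegressionGame.Seeds d n T K N₁ N₂,
          RegressionGame.IsEstimator B (RegressionGame.avgEstimator B sel s)) ∧
        -- it is approximately minimax
        ENNReal.ofReal (1 - δ) ≤ RegressionGame.seedsLaw d n T K N₁ N₂ B η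
          {s | RegressionGame.worstRisk B (RegressionGame.avgEstimator B sel s) ≤
            RegressionGame.minimaxRisk d n B +
              C * (B ^ 2 * (B + 1) * √((n : ℝ) / T)) * (1 + Real.log (T / δ)) ^ p} ∧
        -- the radially extended averaged prior is approximately least favorable
        ENNReal.ofReal (1 - δ) ≤ RegressionGame.seedsLaw d n T K N₁ N₂ B η
          {s | RegressionGame.minimaxRisk d n B -
              C * (B ^ 2 * (B + 1) * √((n : ℝ) / T)) * (1 + Real.log (T / δ)) ^ p ≤
            RegressionGame.bayesRisk n B
              (RegressionGame.radialExtension d (RegressionGame.avgPrior B sel s))} := by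
  refine ⟨48 + 64 * Real.exp 8, 1, by positivity, ?_⟩
  intro d n T _ B δ hn hT hB hδ hδ' η w K N₁ N₂ hη hw hK hN₁ hN₂ sel hsel
  have hT1 : (1 : ℝ) ≤ T := Nat.one_le_cast.2 hT
  have hT0 : (0 : ℝ) < T := one_pos.trans_le hT1
  have hn1 : 1 ≤ √(n : ℝ) := Real.one_le_sqrt.2 (Nat.one_le_cast.2 hn)
  set Λ := B * √(n : ℝ) + 1 with hΛdef
  have hΛ : 0 < Λ := by positivity
  set S := √(T : ℝ) with hSdef
  have hS1 : 1 ≤ S := Real.one_le_sqrt.2 hT1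
  have hTS : (T : ℝ) = S ^ 2 := (Real.sq_sqrt hT0.le).symm
  have hpow : (T : ℝ) ^ (3 / 2 : ℝ) = S ^ 3 := by
    rw [hSdef, Real.sqrt_eq_rpow, ← Real.rpow_natCast, ← Real.rpow_mul hT0.le]
    norm_num
  have hBw : B / w = S ^ 3 := by rw [hw, hpow]; field_simp
  have hS3 : 1 ≤ S ^ 3 := one_le_pow₀ hS1
  have hKge : S ^ 3 ≤ (K : ℝ) := by rw [hK, hBw]; exact Nat.le_ceil _
  have hKle : (K : ℝ) ≤ 2 * S ^ 3 := by
    have := Nat.ceil_lt_add_one (zero_le_one.trans hS3)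
    rw [hK, hBw]
    linarith
  have hN₁ge : S ^ 6 / Λ ^ 2 ≤ (N₁ : ℝ) := by
    rw [show S ^ 6 = (T : ℝ) ^ 3 by rw [hTS]; ring, hN₁]; exact Nat.le_ceil _
  have hN₂ge : (T : ℝ) ^ 4 / Λ ^ 2 ≤ (N₂ : ℝ) := by rw [hN₂]; exact Nat.le_ceil _
  have hK0 : K ≠ 0 := by rintro rfl; norm_num at hKge; linarith
  have hN₁0 : N₁ ≠ 0 := by
    rw [hN₁]; exact (Nat.ceil_pos.2 (by positivity)).ne'
  have hN₂0 : N₂ ≠ 0 := by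
    rw [hN₂]; exact (Nat.ceil_pos.2 (by positivity)).ne'
  have hT0' : T ≠ 0 := Nat.one_le_iff_ne_zero.1 hT
  have hη0 : 0 < η := by rw [hη]; positivity
  set x := 1 + Real.log (T / δ) with hxdef
  have hx1 : 1 ≤ x :=
    le_add_of_nonneg_right (Real.log_nonneg ((one_le_div hδ).2 (hδ'.le.trans hT1)))
  -- With `N₂ ≥ T⁴ / Λ²` this gives `N₂ ε² ≥ 4 x²`, while `K ε B²` stays of order `x B² Λ / √T`.
  set ε := 2 * x * Λ / (T : ℝ) ^ 2 with hεdef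
  have hε0 : 0 ≤ ε := by positivity
  have hcall := isProbabilityMeasure_callLaw (d := d) (n := n) (T := T) (K := K) (N₁ := N₁)
    (B := B) hη0
  have hseeds : IsProbabilityMeasure (seedsLaw d n T K N₁ N₂ B η) := by
    unfold seedsLaw; infer_instance
  have hbad := (seedsLaw_exists_empFreq_ge_le (d := d) (n := n) (T := T) (N₁ := N₁) hB.le hN₂0
    hsel.1 hη0 hε0).trans (ENNReal.ofReal_le_ofReal (failure_probability_le hT1 hΛ hδ hδ'
      (hKle.trans (by rw [hTS]; nlinarith)) hN₂ge))
  -- The free parameter `a` of the noise bound is set to the target rate `B² Λ / √T`.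
  have herr : K * (ε * (4 * B ^ 2)) +
      (T : ℝ)⁻¹ * regretBound n T K N₁ B η (B ^ 2 * Λ / S) + 4 * (B * Λ) * (B / K) ≤
      (48 + 64 * Real.exp 8) * (B ^ 2 * (B + 1) * √((n : ℝ) / T)) * x ^ 1 := by
    have h1 := run_error_le hB hΛ hS1 hx1 hKge hKle hN₁ge
    -- Since `n ≥ 1`, `Λ = B √n + 1 ≤ (B + 1) √n`.
    have h2 : B ^ 2 * Λ / S ≤ B ^ 2 * (B + 1) * √((n : ℝ) / T) := by
      rw [Real.sqrt_div (Nat.cast_nonneg n), ← mul_div_assoc]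
      gcongr ?_ / _
      rw [mul_assoc]
      gcongr
      rw [hΛdef]
      linarith
    rw [regretBound, hη, hεdef, hTS, pow_one]
    rw [show (S ^ 2) ^ 2 = S ^ 4 by ring]
    refine h1.trans ?_
    rw [hTS] at h2
    gcongr
  have hgood : ∀ s : Seeds d n T K N₁ N₂, s ∉ {s | ∃ t j,
      ε ≤ |empFreq (picks B sel s t) j - pickProb d n N₁ B η sel (picks B sel s) t j|} →
      worstRisk B (avgEstimator B sel s) ≤
        (T : ℝ)⁻¹ * ∑ t, bayesRisk n B (radialExtension d (empMeasure (radii B sel s t))) +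
        (48 + 64 * Real.exp 8) * (B ^ 2 * (B + 1) * √((n : ℝ) / T)) * x ^ 1 := fun s hs => by
    simp only [Set.mem_ofPred_eq, not_exists, not_le] at hs
    have h1 := worstRisk_avgEstimator_le hB hT0' hK0 hN₁0 hN₂0 hsel hη0
      (show 0 < B ^ 2 * Λ / S by positivity) s fun t j => (hs t j).le
    exact h1.trans (by gcongr)
  refine ⟨isEstimator_avgEstimator hB.le hT0' hN₂0,
    ofReal_one_sub_le_of_compl_subset _ hδ.le hbad fun s hs => (hgood s hs).trans ?_,
    ofReal_one_sub_le_of_compl_subset _ hδ.le hbad fun s hs => ?_⟩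
  · gcongr
    rw [inv_mul_le_iff₀ hT0]
    refine (Finset.sum_le_sum fun t _ => bayesRisk_empMeasure_le_minimaxRisk hB hN₂0 s t).trans ?_
    simp
  · rw [Set.mem_ofPred_eq, sub_le_iff_le_add]
    refine (minimaxRisk_le_worstRisk (isEstimator_avgEstimator hB.le hT0' hN₂0 s)).trans
      ((hgood s hs).trans ?_)
    gcongr
    exact avg_bayesRisk_le_bayesRisk_avgPrior hB.le hN₂0 s
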